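/- Let $\mathcal M=(\mathcal S,\mathcal A,P,r,\gamma)$ be a Markov decision process with finite state space $\mathcal S$, finite nonempty action space $\mathcal A$, rewards $r(s,a)\in[0,1]$ and discount factor $\gamma\in[0,1)$. For a policy $\pi$ let $V^\pi(s)=\mathbb E[\sum_{t\ge0}\gamma^t r(s_t,a_t)\mid s_0=s,\pi]$, $Q^\pi(s,a)=\mathbb E[\sum_{t\ge0}\gamma^t r(s_t,a_t)\mid s_0=s,a_0=a,\pi]$, $A^\pi=Q^\pi-V^\pi$, $V^\pi(\rho)=\sum_s\rho(s)V^\pi(s)$ and $d^\pi_\rho(s)=(1-\gamma)\,\mathbb E[\sum_{t\ge0}\gamma^t\mathbf 1\{s_t=s\}\mid s_0\sim\rho,\pi]$. Let $V^*=\max_\pi V^\pi$, $Q^*=\max_\pi Q^\pi$, $A^*=Q^*-V^*$, $V^*(\rho)=\sum_s\rho(s)V^*(s)$ and $\mathcal A^*_s=\operatorname{argmax}_a A^*(s,a)$; a policy $\pi$ is optimal if $V^\pi(s)=V^*(s)$ for all $s$. Let $\mu$ and $\rho$ be probability distributions on $\mathcal S$, put $\tilde\mu=\min_s\mu(s)$,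 $\tilde\rho=\min_s\rho(s)$, and assume $\tilde\mu>0$. Let $\pi_\theta(a|s)=\exp(\theta_{s,a})/\sum_{a'}\exp(\theta_{s,a'})$, and let softmax policy gradient (softmax PG) with step sizes $\eta_k$, started at an arbitrary $\theta^0\in\mathbb R^{|\mathcal S|\times|\mathcal A|}$, be $$\theta^{k+1}=\theta^k+\eta_k\nabla_\theta V^{\pi_\theta}(\mu)\big|_{\theta=\theta^k},\qquad \pi^k=\pi_{\theta^k},\quad V^k=V^{\pi^k},\quad \hat A^k_{s,a}=\pi^k(a|s)A^{\pi^k}(s,a).$$ Let $\mathcal S^k=\{s:\max_a|\hat A^k_{s,a}|>0\}$ and $\kappa=\inf_{k\ge0,\,s\in\mathcal S}\sum_{a\in\mathcal A^*_s}\pi^k(a|s)$. Let $C>0$ be a constant and suppose that for every $k$ with $\mathcal S^k\ne\emptyset$ $$\eta_k\ \ge\ \frac{C}{\min_{s\in\mathcal S^k}\max_a|\hat A^k_{s,a}|}.$$ Then $\mathcal S^k=\{s:\max_a\hat A^k_{s,a}>0\}$ for all $k$, $\kappa>0$, and for all $k\ge0$ $$V^*(\rho)-V^k(\rho)\le\left(1-(1-\gamma)\,\tilde\rho\,\frac{\kappa}{|\mathcal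 A|\max_s|\mathcal A^*_s|}\Big(1-\frac1{C\tilde\mu+1}\Big)\right)^k\big(V^*(\rho)-V^0(\rho)\big).$$ If moreover $\tilde\rho>0$ and the optimal policy $\pi^*$ is unique, then, with $d^*_\rho=d^{\pi^*}_\rho$, for all $k\ge0$ $$V^*(\rho)-V^k(\rho)\le\left(1-(1-\gamma)\left\|\frac{d^*_\rho}{\rho}\right\|_\infty^{-1}\frac{\kappa}{|\mathcal A|}\Big(1-\frac1{C\tilde\mu+1}\Big)\right)^k\big(V^*(\rho)-V^0(\rho)\big).$$ In particular, for $\tilde\rho>0$ softmax PG converges linearly. -/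

import Mathlib

open scoped Gradient

/-- A finite discounted Markov decision process with state space `S`, action space `A`,
transition probabilities `P s a s'` (from `s` to `s'` under action `a`), rewards in `[0, 1]` and
discount factor in `[0, 1)`. -/
structure FiniteMDP (S A : Type*) [Fintype S] [Fintype A] where
  P : S → A → S → ℝ
  r : S → A → ℝ
  γ : ℝ
  P_mem : ∀ s a, P s a ∈ stdSimplex ℝ S
  r_mem : ∀ s a, r s a ∈ Set.Icc (0 : ℝ) 1
  γ_nonneg : 0 ≤ γ
  γ_lt_one : γ < 1

/-- The set `Π` of all (stationary randomized) policies; `π s a` is `π(a|s)`. -/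
def policies (S A : Type*) [Fintype A] : Set (S → A → ℝ) :=
  {π | ∀ s, π s ∈ stdSimplex ℝ A}

/-- The softmax parametrization `π_θ(a|s) = exp(θ_{s,a}) / ∑_{a'} exp(θ_{s,a'})`. -/
noncomputable def softmaxPolicy {S A : Type*} [Fintype A]
    (θ : EuclideanSpace ℝ (S × A)) : S → A → ℝ :=
  fun s a => Real.exp (θ (s, a)) / ∑ a', Real.exp (θ (s, a'))

namespace FiniteMDP

section Values

variable {S A : Type*} [Fintype S] [Fintype A] (M : FiniteMDP S A)

/-- The law of `(s_t, a_t)` when `(s_0, a_0)` has law `ν`, `s_{t+1} ∼ P(·|s_t, a_t)` and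
`a_{t+1} ∼ π(·|s_{t+1})`. -/
noncomputable def stateActionLaw (π : S → A → ℝ) (ν : S → A → ℝ) : ℕ → S → A → ℝ
  | 0 => ν
  | t + 1 => fun s' a' =>
      (∑ s, ∑ a, stateActionLaw π ν t s a * M.P s a s') * π s' a'

/-- The expected discounted return `E[∑_t γ^t r(s_t, a_t)]` under `π` when `(s_0, a_0)` has
law `ν`. -/
noncomputable def expectedReturn (π : S → A → ℝ) (ν : S → A → ℝ) : ℝ :=
  ∑' t : ℕ, M.γ ^ t * ∑ s, ∑ a, M.stateActionLaw π ν t s a * M.r s a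

open Classical in
/-- The state value `V^π(s)`: start at `s_0 = s`, `a_0 ∼ π(·|s)`. -/
noncomputable def V (π : S → A → ℝ) (s : S) : ℝ :=
  M.expectedReturn π (Pi.single s (π s))

open Classical in
/-- The action value `Q^π(s, a)`: start at `s_0 = s`, `a_0 = a`. -/
noncomputable def Q (π : S → A → ℝ) (s : S) (a : A) : ℝ :=
  M.expectedReturn π (Pi.single s (Pi.single a 1))

/-- The advantage `A^π(s, a) = Q^π(s, a) - V^π(s)`. -/
noncomputable def adv (π : S → A → ℝ) (s : S) (a : A) : ℝ := M.Q π s a - M.V π s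

/-- `Â^π(s, a) = π(a|s) A^π(s, a)`. -/
noncomputable def advHat (π : S → A → ℝ) (s : S) (a : A) : ℝ := π s a * M.adv π s a

/-- `V^π(ρ) = E_{s ∼ ρ}[V^π(s)]`. -/
noncomputable def valueAt (π : S → A → ℝ) (ρ : S → ℝ) : ℝ := ∑ s, ρ s * M.V π s

/-- The discounted state visitation measure
`d_ρ^π(s) = (1 - γ) E[∑_t γ^t 1{s_t = s} | s_0 ∼ ρ, π]`. -/
noncomputable def visitation (π : S → A → ℝ) (ρ : S → ℝ) (s : S) : ℝ :=
  (1 - M.γ) * ∑' t : ℕ, M.γ ^ t * ∑ a, M.stateActionLaw π (fun s a => ρ s * π s a) t s a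

/-- The optimal state value `V^*(s) = sup_π V^π(s)`. -/
noncomputable def Vstar (s : S) : ℝ := ⨆ π : policies S A, M.V π s

/-- The optimal action value `Q^*(s, a) = sup_π Q^π(s, a)`. -/
noncomputable def Qstar (s : S) (a : A) : ℝ := ⨆ π : policies S A, M.Q π s a

/-- `V^*(ρ) = E_{s ∼ ρ}[V^*(s)]`. -/
noncomputable def valueStarAt (ρ : S → ℝ) : ℝ := ∑ s, ρ s * M.Vstar s

/-- The optimal advantage `A^* = Q^* - V^*`. -/
noncomputable def advStar (s : S) (a : A) : ℝ := M.Qstar s a - M.Vstar s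

/-- A policy is optimal if it attains the optimal value at every state. -/
def IsOptimal (π : S → A → ℝ) : Prop :=
  π ∈ policies S A ∧ ∀ s, M.V π s = M.Vstar s

open Classical in
/-- The set of optimal actions `𝒜*_s = argmax_a A^*(s, a)`. -/
noncomputable def optimalActions (s : S) : Finset A :=
  {a | ∀ a', M.advStar s a' ≤ M.advStar s a}

open Classical in
/-- `b^π_s`: the probability that `π(·|s)` puts on non-optimal actions. -/
noncomputable def b (π : S → A → ℝ) (s : S) : ℝ :=
  ∑ a with a ∉ M.optimalActions s, π s a

/-- `κ = inf_{k ≥ 0, s} (1 - b^{π^k}_s)` for a sequence of policies `π^k`. -/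
noncomputable def kappa (π : ℕ → S → A → ℝ) : ℝ :=
  ⨅ p : ℕ × S, (1 - M.b (π p.1) p.2)

/-- The states at which `max_a |Â^π(s, a)| > 0`. -/
def activeStates (π : S → A → ℝ) : Set S := {s | 0 < ⨆ a, |M.advHat π s a|}

/-- `θ^k` is generated by softmax policy gradient with step sizes `η_k`: gradient ascent on
`θ ↦ V^{π_θ}(μ)`. -/
def IsSoftmaxPG (μ : S → ℝ) (η : ℕ → ℝ) (θ : ℕ → EuclideanSpace ℝ (S × A)) : Prop :=
  ∀ k, θ (k + 1) = θ k + η k • ∇ (fun ϑ => M.valueAt (softmaxPolicy ϑ) μ) (θ k)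

end Values

end FiniteMDP

/-! By the policy gradient theorem one step of softmax PG adds `η_k * d(s) * Â(s, a)` to the logit
at `(s, a)`, where `d` is the unnormalized discounted occupancy started from `μ`. Each state
therefore performs its own multiplicative-weights update with step `η_k * d(s)`. As `d(s) ≥ μ(s)`,
the assumed lower bound on `η_k` makes this step times `max_a |Â(s, a)|` at least `c = C * μ̃`
wherever that maximum is positive. Only this remains of the gradient: it is recorded in
`SoftmaxDynamics`.

Such an update raises `V` at every state by at least `max_a |Â(s, a)| / |A| * (1 - 1/(c + 1))`
(`softmax_step_improvement`, `gain_le`). Linear convergence thus needs the reverse inequality, that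
the suboptimality is controlled by the `max_a |Â(s, a)|`. Conditioning `π^k` on the optimal actions
yields an optimal policy whose mean advantage over `π^k` is a sum of `Â`'s divided by `1 - b ≥ κ`;
the performance difference lemma turns this into gradient domination with constant `κ`.

The remaining point is `κ > 0`. The values increase, hence converge to some `v`, and the gains force
`Â → 0`. An action with positive limiting advantage would keep its probability bounded below
(`exists_pos_eventually_le_softmax`), contradicting `Â → 0`. So `v` satisfies the Bellman inequality
and equals `V^*`. Then `Â → 0` drives the probabilities of nonoptimal actions to zero, so `1 - b →
1`. -/

open Filter Topology

/-! ### Policy evaluation, Bellman equations and performance differences -/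

namespace FiniteMDP

section Evaluation

set_option linter.unusedSectionVars false

variable {S A : Type*} [Fintype S] [Fintype A] (M : FiniteMDP S A)

/-- One step of the evolution of the state-action law under the policy `π`. -/
noncomputable def lawStep (π ν : S → A → ℝ) : S → A → ℝ :=
  fun s' a' => (∑ s, ∑ a, ν s a * M.P s a s') * π s' a'

lemma P_nonneg (s : S) (a : A) (s' : S) : 0 ≤ M.P s a s' := (M.P_mem s a).1 s'

lemma sum_P (s : S) (a : A) : ∑ s', M.P s a s' = 1 := (M.P_mem s a).2

lemma one_sub_γ_pos : 0 < 1 - M.γ := sub_pos.2 M.γ_lt_one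

lemma stateActionLaw_succ (π ν : S → A → ℝ) (t : ℕ) :
    M.stateActionLaw π ν (t + 1) = M.lawStep π (M.stateActionLaw π ν t) := rfl

variable {M} {π π' : S → A → ℝ}

lemma policy_nonneg (hπ : π ∈ policies S A) (s : S) (a : A) : 0 ≤ π s a := (hπ s).1 a

lemma policy_sum (hπ : π ∈ policies S A) (s : S) : ∑ a, π s a = 1 := (hπ s).2

lemma lawStep_nonneg (hπ : π ∈ policies S A) {ν : S → A → ℝ} (hν : ∀ s a, 0 ≤ ν s a)
    (s : S) (a : A) : 0 ≤ M.lawStep π ν s a :=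
  mul_nonneg (Finset.sum_nonneg fun _ _ => Finset.sum_nonneg fun _ _ =>
    mul_nonneg (hν _ _) (M.P_nonneg _ _ _)) (policy_nonneg hπ s a)

lemma sum_lawStep_mul (f : S → A → ℝ) (ν : S → A → ℝ) :
    ∑ s', ∑ a', M.lawStep π ν s' a' * f s' a' =
      ∑ s, ∑ a, ν s a * ∑ s', M.P s a s' * ∑ a', π s' a' * f s' a' := by
  simp only [lawStep, Finset.sum_mul, Finset.mul_sum]
  calc _ = ∑ s', ∑ s, ∑ a', ∑ a, ν s a * M.P s a s' * π s' a' * f s' a' :=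
        Finset.sum_congr rfl fun _ _ => Finset.sum_comm
    _ = ∑ s, ∑ s', ∑ a', ∑ a, ν s a * M.P s a s' * π s' a' * f s' a' := Finset.sum_comm
    _ = ∑ s, ∑ s', ∑ a, ∑ a', ν s a * M.P s a s' * π s' a' * f s' a' :=
        Finset.sum_congr rfl fun _ _ => Finset.sum_congr rfl fun _ _ => Finset.sum_comm
    _ = ∑ s, ∑ a, ∑ s', ∑ a', ν s a * M.P s a s' * π s' a' * f s' a' :=
        Finset.sum_congr rfl fun _ _ => Finset.sum_comm
    _ = _ := by simp only [mul_assoc]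

lemma sum_lawStep (hπ : π ∈ policies S A) (ν : S → A → ℝ) :
    ∑ s, ∑ a, M.lawStep π ν s a = ∑ s, ∑ a, ν s a := by
  have h := sum_lawStep_mul (M := M) (π := π) (fun _ _ => 1) ν
  simpa [policy_sum hπ, M.sum_P] using h

lemma stateActionLaw_nonneg (hπ : π ∈ policies S A) {ν : S → A → ℝ} (hν : ∀ s a, 0 ≤ ν s a)
    (t : ℕ) (s : S) (a : A) : 0 ≤ M.stateActionLaw π ν t s a := by
  induction t generalizing s a with
  | zero => exact hν s a
  | succ t ih => exact lawStep_nonneg hπ ih s a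

lemma sum_stateActionLaw (hπ : π ∈ policies S A) (ν : S → A → ℝ) (t : ℕ) :
    ∑ s, ∑ a, M.stateActionLaw π ν t s a = ∑ s, ∑ a, ν s a := by
  induction t with
  | zero => rfl
  | succ t ih => rw [stateActionLaw_succ, sum_lawStep hπ, ih]

lemma stateActionLaw_le (hπ : π ∈ policies S A) {ν : S → A → ℝ} (hν : ∀ s a, 0 ≤ ν s a)
    (t : ℕ) (s : S) (a : A) : M.stateActionLaw π ν t s a ≤ ∑ s, ∑ a, ν s a := by
  rw [← sum_stateActionLaw (M := M) hπ ν t]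
  have h := stateActionLaw_nonneg (M := M) hπ hν t
  exact (Finset.single_le_sum (fun a _ => h s a) (Finset.mem_univ a)).trans
    (Finset.single_le_sum (f := fun s => ∑ a, M.stateActionLaw π ν t s a)
      (fun s _ => Finset.sum_nonneg fun a _ => h s a) (Finset.mem_univ s))

lemma summable_stateActionLaw (hπ : π ∈ policies S A) {ν : S → A → ℝ}
    (hν : ∀ s a, 0 ≤ ν s a) (s : S) (a : A) :
    Summable fun t : ℕ => M.γ ^ t * M.stateActionLaw π ν t s a :=
  Summable.of_nonneg_of_le
    (fun t => mul_nonneg (pow_nonneg M.γ_nonneg t) (stateActionLaw_nonneg hπ hν t s a))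
    (fun t => mul_le_mul_of_nonneg_left (stateActionLaw_le hπ hν t s a)
      (pow_nonneg M.γ_nonneg t))
    ((summable_geometric_of_lt_one M.γ_nonneg M.γ_lt_one).mul_right _)

variable (M π) in
/-- The unnormalized discounted state-action occupancy measure. -/
noncomputable def occupancy (ν : S → A → ℝ) (s : S) (a : A) : ℝ :=
  ∑' t : ℕ, M.γ ^ t * M.stateActionLaw π ν t s a

lemma occupancy_nonneg (hπ : π ∈ policies S A) {ν : S → A → ℝ} (hν : ∀ s a, 0 ≤ ν s a)
    (s : S) (a : A) : 0 ≤ M.occupancy π ν s a :=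
  tsum_nonneg fun t => mul_nonneg (pow_nonneg M.γ_nonneg t) (stateActionLaw_nonneg hπ hν t s a)

lemma occupancy_eq_add (hπ : π ∈ policies S A) {ν : S → A → ℝ} (hν : ∀ s a, 0 ≤ ν s a)
    (s : S) (a : A) :
    M.occupancy π ν s a = ν s a + M.γ * M.lawStep π (M.occupancy π ν) s a := by
  have hs := summable_stateActionLaw (M := M) hπ hν
  rw [occupancy, (hs s a).tsum_eq_zero_add]
  have h : HasSum (fun t : ℕ => M.γ * ((∑ s', ∑ a',
      M.γ ^ t * M.stateActionLaw π ν t s' a' * M.P s' a' s) * π s a))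
      (M.γ * M.lawStep π (M.occupancy π ν) s a) :=
    (HasSum.mul_right _ (hasSum_sum fun s' _ => hasSum_sum fun a' _ =>
      (hs s' a').hasSum.mul_right _)).mul_left _
  rw [← h.tsum_eq]
  simp only [pow_zero, one_mul, stateActionLaw, pow_succ, Finset.mul_sum, Finset.sum_mul]
  congr 1
  refine tsum_congr fun t => Finset.sum_congr rfl fun _ _ => Finset.sum_congr rfl fun _ _ => ?_
  ring

variable (M π) in
/-- The action of the transition kernel of the state-action chain on functions. -/
noncomputable def kernelApply (f : S → A → ℝ) : S → A → ℝ :=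
  fun s a => ∑ s', M.P s a s' * ∑ a', π s' a' * f s' a'

/-- Duality: the evolution of the law is moved onto the test function, which makes the dependence on
the initial law `ν` visibly linear. -/
lemma sum_stateActionLaw_mul (ν : S → A → ℝ) (t : ℕ) (f : S → A → ℝ) :
    ∑ s, ∑ a, M.stateActionLaw π ν t s a * f s a =
      ∑ s, ∑ a, ν s a * (M.kernelApply π)^[t] f s a := by
  induction t generalizing f with
  | zero => rfl
  | succ t ih =>
    rw [stateActionLaw_succ, sum_lawStep_mul, Function.iterate_succ_apply]
    exact ih (M.kernelApply π f)

open Classical in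
lemma single_single_apply (s s' : S) (a a' : A) :
    (Pi.single s (Pi.single a 1) : S → A → ℝ) s' a' = if s' = s ∧ a' = a then 1 else 0 := by
  by_cases h : s' = s
  · subst h; by_cases h : a' = a <;> simp [h]
  · simp [h]

open Classical in
lemma sum_single_single_mul (s : S) (a : A) (f : S → A → ℝ) :
    ∑ s', ∑ a', (Pi.single s (Pi.single a 1) : S → A → ℝ) s' a' * f s' a' = f s a := by
  rw [Fintype.sum_eq_single s, Fintype.sum_eq_single a]
  · simp
  · intro a' h; simp [h]
  · intro s' h; simp [h]

open Classical in
lemma single_single_nonneg (s : S) (a : A) (s' : S) (a' : A) :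
    0 ≤ (Pi.single s (Pi.single a 1) : S → A → ℝ) s' a' := by
  rw [single_single_apply]; split_ifs <;> norm_num

open Classical in
lemma Q_eq_tsum (s : S) (a : A) :
    M.Q π s a = ∑' t : ℕ, M.γ ^ t * (M.kernelApply π)^[t] M.r s a := by
  simp only [Q, expectedReturn, sum_stateActionLaw_mul, sum_single_single_mul]

open Classical in
lemma hasSum_Q (hπ : π ∈ policies S A) (s : S) (a : A) :
    HasSum (fun t : ℕ => M.γ ^ t * (M.kernelApply π)^[t] M.r s a) (M.Q π s a) := by
  rw [Q_eq_tsum]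
  refine Summable.hasSum ?_
  have hs := fun s' a' => (summable_stateActionLaw (M := M) hπ
    (single_single_nonneg s a) s' a').mul_right (M.r s' a')
  refine (summable_sum (s := Finset.univ) fun s' _ =>
    summable_sum (s := Finset.univ) fun a' _ => hs s' a').congr fun t => ?_
  simp only [mul_assoc, ← Finset.mul_sum]
  rw [sum_stateActionLaw_mul, sum_single_single_mul]

lemma expectedReturn_eq_sum_Q (hπ : π ∈ policies S A) (ν : S → A → ℝ) :
    M.expectedReturn π ν = ∑ s, ∑ a, ν s a * M.Q π s a := by
  have h : HasSum (fun t : ℕ => ∑ s, ∑ a, ν s a * (M.γ ^ t * (M.kernelApply π)^[t] M.r s a))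
      (∑ s, ∑ a, ν s a * M.Q π s a) :=
    hasSum_sum fun s _ => hasSum_sum fun a _ => (hasSum_Q hπ s a).mul_left _
  rw [← h.tsum_eq, expectedReturn]
  refine tsum_congr fun t => ?_
  rw [sum_stateActionLaw_mul, Finset.mul_sum]
  refine Finset.sum_congr rfl fun s _ => ?_
  rw [Finset.mul_sum]
  exact Finset.sum_congr rfl fun a _ => by ring

lemma V_eq (hπ : π ∈ policies S A) (s : S) : M.V π s = ∑ a, π s a * M.Q π s a := by
  classical
  rw [V, expectedReturn_eq_sum_Q hπ, Fintype.sum_eq_single s]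
  · simp
  · intro s' h; simp [h]

lemma Q_eq (hπ : π ∈ policies S A) (s : S) (a : A) :
    M.Q π s a = M.r s a + M.γ * ∑ s', M.P s a s' * M.V π s' := by
  have h1 : HasSum (fun t : ℕ => M.γ * ∑ s', M.P s a s' * ∑ a', π s' a' *
      (M.γ ^ t * (M.kernelApply π)^[t] M.r s' a'))
      (M.γ * ∑ s', M.P s a s' * ∑ a', π s' a' * M.Q π s' a') :=
    (hasSum_sum fun s' _ => (hasSum_sum fun a' _ => (hasSum_Q hπ s' a').mul_left _).mul_left _
      ).mul_left _
  rw [← (hasSum_Q hπ s a).tsum_eq, (hasSum_Q hπ s a).summable.tsum_eq_zero_add]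
  simp only [V_eq hπ, ← h1.tsum_eq, pow_zero, one_mul, Function.iterate_zero, id]
  congr 1
  refine tsum_congr fun t => ?_
  rw [Function.iterate_succ_apply', kernelApply, Finset.mul_sum, Finset.mul_sum]
  refine Finset.sum_congr rfl fun s' _ => ?_
  simp only [Finset.mul_sum]
  refine Finset.sum_congr rfl fun a' _ => ?_
  ring

/-- Minimum principle for the discounted chain. -/
lemma nonneg_of_discounted_le (hπ : π ∈ policies S A) {g : S → ℝ}
    (hg : ∀ s, M.γ * ∑ a, π s a * ∑ s', M.P s a s' * g s' ≤ g s) (s : S) : 0 ≤ g s := by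
  obtain ⟨s₀, -, h₀⟩ := Finset.exists_min_image Finset.univ g ⟨s, Finset.mem_univ s⟩
  -- At a minimizer the average of `g` is at least `g s₀`, so the hypothesis gives `γ * g s₀ ≤ g
  -- s₀`, which fails for negative `g s₀` as `γ < 1`.
  have h1 : g s₀ ≤ ∑ a, π s₀ a * ∑ s', M.P s₀ a s' * g s' := by
    calc g s₀ = ∑ a, π s₀ a * ∑ s', M.P s₀ a s' * g s₀ := by
          simp [← Finset.sum_mul, M.sum_P, policy_sum hπ]
      _ ≤ _ := Finset.sum_le_sum fun a _ => mul_le_mul_of_nonneg_left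
          (Finset.sum_le_sum fun s' _ => mul_le_mul_of_nonneg_left
            (h₀ s' (Finset.mem_univ _)) (M.P_nonneg _ _ _)) (policy_nonneg hπ _ _)
  have h2 := (mul_le_mul_of_nonneg_left h1 M.γ_nonneg).trans (hg s₀)
  have h3 : 0 ≤ g s₀ := by
    have := M.one_sub_γ_pos
    by_contra h
    nlinarith
  exact h3.trans (h₀ s (Finset.mem_univ s))

/-- A function whose Bellman residual under `π` is at most `c` is at most `c / (1 - γ)`. -/
lemma le_div_of_le_add_discounted (hπ : π ∈ policies S A) {g : S → ℝ} {c : ℝ}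
    (hg : ∀ s, g s ≤ c + M.γ * ∑ a, π s a * ∑ s', M.P s a s' * g s') (s : S) :
    g s ≤ c / (1 - M.γ) := by
  have h := nonneg_of_discounted_le (M := M) hπ (g := fun s => c / (1 - M.γ) - g s) (fun s => by
    simp only [mul_sub, Finset.sum_sub_distrib, ← Finset.sum_mul, M.sum_P, policy_sum hπ, one_mul]
    have h1 := hg s
    have h2 : c / (1 - M.γ) = c + M.γ * (c / (1 - M.γ)) := by
      have := M.one_sub_γ_pos.ne'
      field_simp
      ring
    linarith) s
  simpa using h

lemma V_bellman (hπ : π ∈ policies S A) (s : S) :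
    M.V π s = ∑ a, π s a * (M.r s a + M.γ * ∑ s', M.P s a s' * M.V π s') := by
  rw [V_eq hπ]; simp only [← Q_eq hπ]

lemma discounted_sum_comm (g : S → ℝ) (s : S) :
    M.γ * ∑ a, π s a * ∑ s', M.P s a s' * g s' =
      ∑ a, π s a * (M.γ * ∑ s', M.P s a s' * g s') := by
  rw [Finset.mul_sum]; exact Finset.sum_congr rfl fun _ _ => by ring

lemma V_nonneg (hπ : π ∈ policies S A) (s : S) : 0 ≤ M.V π s := by
  refine nonneg_of_discounted_le (M := M) hπ (fun s => ?_) s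
  rw [V_bellman hπ s, discounted_sum_comm]
  exact Finset.sum_le_sum fun a _ => mul_le_mul_of_nonneg_left
    (le_add_of_nonneg_left (M.r_mem s a).1) (policy_nonneg hπ _ _)

lemma V_le (hπ : π ∈ policies S A) (s : S) : M.V π s ≤ 1 / (1 - M.γ) := by
  refine le_div_of_le_add_discounted (M := M) hπ (fun s => ?_) s
  conv_lhs => rw [V_bellman hπ s]
  rw [discounted_sum_comm]
  simp only [mul_add, Finset.sum_add_distrib]
  refine add_le_add_left ?_ _
  calc _ ≤ ∑ a, π s a * 1 := Finset.sum_le_sum fun a _ => mul_le_mul_of_nonneg_left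
        (M.r_mem s a).2 (policy_nonneg hπ _ _)
    _ = 1 := by simp [policy_sum hπ]

lemma sum_P_mul_nonneg {g : S → ℝ} (hg : ∀ s, 0 ≤ g s) (s : S) (a : A) :
    0 ≤ ∑ s', M.P s a s' * g s' :=
  Finset.sum_nonneg fun _ _ => mul_nonneg (M.P_nonneg _ _ _) (hg _)

lemma Q_nonneg (hπ : π ∈ policies S A) (s : S) (a : A) : 0 ≤ M.Q π s a := by
  rw [Q_eq hπ]
  exact add_nonneg (M.r_mem s a).1 (mul_nonneg M.γ_nonneg (sum_P_mul_nonneg (V_nonneg hπ) s a))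

lemma Q_le (hπ : π ∈ policies S A) (s : S) (a : A) : M.Q π s a ≤ 1 / (1 - M.γ) := by
  rw [Q_eq hπ]
  have h1 : ∑ s', M.P s a s' * M.V π s' ≤ 1 / (1 - M.γ) :=
    calc _ ≤ ∑ s', M.P s a s' * (1 / (1 - M.γ)) := Finset.sum_le_sum fun s' _ =>
          mul_le_mul_of_nonneg_left (V_le hπ s') (M.P_nonneg _ _ _)
      _ = _ := by rw [← Finset.sum_mul, M.sum_P, one_mul]
  have h2 := mul_le_mul_of_nonneg_left h1 M.γ_nonneg
  have h3 : 1 / (1 - M.γ) = 1 + M.γ * (1 / (1 - M.γ)) := by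
    have := M.one_sub_γ_pos.ne'
    field_simp
    ring
  linarith [(M.r_mem s a).2]

lemma abs_adv_le (hπ : π ∈ policies S A) (s : S) (a : A) :
    |M.adv π s a| ≤ 1 / (1 - M.γ) := by
  rw [adv, abs_le]
  constructor <;> linarith [Q_nonneg (M := M) hπ s a, Q_le (M := M) hπ s a,
    V_nonneg (M := M) hπ s, V_le (M := M) hπ s]

lemma sum_mul_adv (s : S) :
    ∑ a, π' s a * M.adv π s a = ∑ a, π' s a * M.Q π s a - (∑ a, π' s a) * M.V π s := by
  simp only [adv, mul_sub, Finset.sum_sub_distrib, Finset.sum_mul]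

lemma sum_advHat (hπ : π ∈ policies S A) (s : S) : ∑ a, M.advHat π s a = 0 := by
  simp only [advHat]
  rw [sum_mul_adv, policy_sum hπ, V_eq hπ, one_mul, sub_self]

/-- Performance difference, in one-step form. -/
lemma V_sub_V_eq (hπ : π ∈ policies S A) (hπ' : π' ∈ policies S A) (s : S) :
    M.V π' s - M.V π s = ∑ a, π' s a * M.adv π s a +
      M.γ * ∑ a, π' s a * ∑ s', M.P s a s' * (M.V π' s' - M.V π s') := by
  rw [sum_mul_adv, policy_sum hπ', V_eq hπ', one_mul, discounted_sum_comm]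
  have : ∀ a, M.Q π' s a = M.Q π s a +
      M.γ * ∑ s', M.P s a s' * (M.V π' s' - M.V π s') := fun a => by
    rw [Q_eq hπ', Q_eq hπ]
    simp only [mul_sub, Finset.sum_sub_distrib]
    ring
  simp only [this, mul_add, Finset.sum_add_distrib]
  ring

/-- With nonnegative one-step gains, the minimum principle makes `V^π' - V^π` nonnegative; its
discounted future part can then be dropped. -/
lemma sum_mul_adv_le_V_sub_V (hπ : π ∈ policies S A) (hπ' : π' ∈ policies S A)
    (h : ∀ s, 0 ≤ ∑ a, π' s a * M.adv π s a) (s : S) :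
    ∑ a, π' s a * M.adv π s a ≤ M.V π' s - M.V π s := by
  have h0 : ∀ s, 0 ≤ M.V π' s - M.V π s :=
    nonneg_of_discounted_le (M := M) hπ' fun s => by
      conv_rhs => rw [V_sub_V_eq hπ hπ']
      exact le_add_of_nonneg_left (h s)
  rw [V_sub_V_eq hπ hπ']
  exact le_add_of_nonneg_right (mul_nonneg M.γ_nonneg (Finset.sum_nonneg fun a _ =>
    mul_nonneg (policy_nonneg hπ' _ _) (sum_P_mul_nonneg h0 _ _)))

variable (M π) in
/-- The unnormalized discounted state occupancy measure with initial distribution `ρ`. -/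
noncomputable def stateOccupancy (ρ : S → ℝ) (s : S) : ℝ :=
  ∑ a, M.occupancy π (fun s a => ρ s * π s a) s a

variable {ρ : S → ℝ}

lemma visitation_eq (hπ : π ∈ policies S A) (hρ : ∀ s, 0 ≤ ρ s) (s : S) :
    M.visitation π ρ s = (1 - M.γ) * M.stateOccupancy π ρ s := by
  have hν : ∀ s a, 0 ≤ ρ s * π s a := fun s a => mul_nonneg (hρ s) (policy_nonneg hπ s a)
  rw [visitation, stateOccupancy]
  congr 1
  simp only [Finset.mul_sum]
  exact (hasSum_sum fun a _ => (summable_stateActionLaw (M := M) hπ hν s a).hasSum).tsum_eq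

/-- The initial law and every later step carry the factor `π s a`, so the occupancy disintegrates
along `π`. -/
lemma occupancy_eq_stateOccupancy_mul (hπ : π ∈ policies S A) (hρ : ∀ s, 0 ≤ ρ s)
    (s : S) (a : A) : M.occupancy π (fun s a => ρ s * π s a) s a =
      M.stateOccupancy π ρ s * π s a := by
  have hν : ∀ s a, 0 ≤ ρ s * π s a := fun s a => mul_nonneg (hρ s) (policy_nonneg hπ s a)
  simp only [stateOccupancy, occupancy_eq_add (M := M) hπ hν s, lawStep]
  simp only [Finset.sum_add_distrib, ← Finset.mul_sum, policy_sum hπ]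
  ring

lemma stateOccupancy_eq_add (hπ : π ∈ policies S A) (hρ : ∀ s, 0 ≤ ρ s) (s' : S) :
    M.stateOccupancy π ρ s' = ρ s' +
      M.γ * ∑ s, ∑ a, M.stateOccupancy π ρ s * π s a * M.P s a s' := by
  have hν : ∀ s a, 0 ≤ ρ s * π s a := fun s a => mul_nonneg (hρ s) (policy_nonneg hπ s a)
  simp only [← occupancy_eq_stateOccupancy_mul hπ hρ]
  rw [stateOccupancy]
  simp only [occupancy_eq_add (M := M) hπ hν s', lawStep, Finset.sum_add_distrib,
    ← Finset.mul_sum, policy_sum hπ, mul_one]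

lemma stateOccupancy_nonneg (hπ : π ∈ policies S A) (hρ : ∀ s, 0 ≤ ρ s) (s : S) :
    0 ≤ M.stateOccupancy π ρ s :=
  Finset.sum_nonneg fun a _ =>
    occupancy_nonneg hπ (fun s a => mul_nonneg (hρ s) (policy_nonneg hπ s a)) s a

/-- Time zero alone contributes `ρ`. This is where `μ̃` enters the rate. -/
lemma le_stateOccupancy (hπ : π ∈ policies S A) (hρ : ∀ s, 0 ≤ ρ s) (s : S) :
    ρ s ≤ M.stateOccupancy π ρ s := by
  rw [stateOccupancy_eq_add hπ hρ]
  exact le_add_of_nonneg_right (mul_nonneg M.γ_nonneg (Finset.sum_nonneg fun s _ =>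
    Finset.sum_nonneg fun a _ => mul_nonneg (mul_nonneg (stateOccupancy_nonneg hπ hρ s)
      (policy_nonneg hπ s a)) (M.P_nonneg _ _ _)))

/-- The flow equation for the occupancy, paired with `g`: integrating against the occupancy inverts
the operator `1 - γ P_π`. -/
lemma sum_stateOccupancy_mul_residual (hπ : π ∈ policies S A) (hρ : ∀ s, 0 ≤ ρ s) (g : S → ℝ) :
    ∑ s, M.stateOccupancy π ρ s * (g s - M.γ * ∑ a, π s a * ∑ s', M.P s a s' * g s') =
      ∑ s, ρ s * g s := by
  have h : ∑ s', M.stateOccupancy π ρ s' * g s' = ∑ s', ρ s' * g s' +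
      ∑ s, M.stateOccupancy π ρ s * (M.γ * ∑ a, π s a * ∑ s', M.P s a s' * g s') := by
    conv_lhs =>
      enter [2, s']
      rw [stateOccupancy_eq_add hπ hρ s', add_mul]
    rw [Finset.sum_add_distrib]
    congr 1
    simp only [Finset.mul_sum, Finset.sum_mul]
    rw [Finset.sum_comm]
    refine Finset.sum_congr rfl fun s _ => ?_
    rw [Finset.sum_comm]
    refine Finset.sum_congr rfl fun a _ => Finset.sum_congr rfl fun s' _ => ?_
    ring
  simp only [mul_sub, Finset.sum_sub_distrib]
  linarith

/-- Performance difference lemma. -/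
lemma valueAt_sub_valueAt (hπ : π ∈ policies S A) (hπ' : π' ∈ policies S A)
    (hρ : ∀ s, 0 ≤ ρ s) :
    M.valueAt π' ρ - M.valueAt π ρ =
      ∑ s, M.stateOccupancy π' ρ s * ∑ a, π' s a * M.adv π s a := by
  have h := sum_stateOccupancy_mul_residual (M := M) hπ' hρ (fun s => M.V π' s - M.V π s)
  rw [valueAt, valueAt, ← Finset.sum_sub_distrib]
  simp only [← mul_sub]
  rw [← h]
  refine Finset.sum_congr rfl fun s _ => ?_
  rw [V_sub_V_eq hπ hπ' s, add_sub_cancel_right]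

end Evaluation
end FiniteMDP

/-! ### Differentiability of the softmax parametrization -/

section Softmax

set_option linter.unusedSectionVars false

variable {S A : Type*} [Fintype S] [Fintype A] [Nonempty A]

lemma softmaxPolicy_sum_pos (θ : EuclideanSpace ℝ (S × A)) (s : S) :
    0 < ∑ a, Real.exp (θ (s, a)) :=
  Finset.sum_pos (fun _ _ => Real.exp_pos _) Finset.univ_nonempty

lemma softmaxPolicy_pos (θ : EuclideanSpace ℝ (S × A)) (s : S) (a : A) :
    0 < softmaxPolicy θ s a :=
  div_pos (Real.exp_pos _) (softmaxPolicy_sum_pos θ s)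

lemma softmaxPolicy_mem (θ : EuclideanSpace ℝ (S × A)) : softmaxPolicy θ ∈ policies S A :=
  fun s => ⟨fun a => (softmaxPolicy_pos θ s a).le, by
    simp only [softmaxPolicy, ← Finset.sum_div, div_self (softmaxPolicy_sum_pos θ s).ne']⟩

lemma hasFDerivAt_softmaxPolicy (θ : EuclideanSpace ℝ (S × A)) (s : S) (a : A) :
    HasFDerivAt (fun ϑ : EuclideanSpace ℝ (S × A) => softmaxPolicy ϑ s a)
      (softmaxPolicy θ s a • ((EuclideanSpace.proj (s, a) : EuclideanSpace ℝ (S × A) →L[ℝ] ℝ) -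
        ∑ a', softmaxPolicy θ s a' • (EuclideanSpace.proj (s, a') : EuclideanSpace ℝ (S × A) →L[ℝ] ℝ))) θ := by
  have he : ∀ a, HasFDerivAt (fun ϑ : EuclideanSpace ℝ (S × A) => Real.exp (ϑ (s, a)))
      (Real.exp (θ (s, a)) • (EuclideanSpace.proj (s, a) : EuclideanSpace ℝ (S × A) →L[ℝ] ℝ)) θ := fun a =>
    (EuclideanSpace.proj (s, a) : EuclideanSpace ℝ (S × A) →L[ℝ] ℝ).hasFDerivAt.exp
  have hs := HasFDerivAt.fun_sum (u := Finset.univ) fun a _ => he a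
  have hZ := (softmaxPolicy_sum_pos θ s).ne'
  have hd := (he a).fun_mul ((hasDerivAt_inv hZ).comp_hasFDerivAt θ hs)
  simp only [softmaxPolicy, div_eq_mul_inv]
  refine hd.congr_fderiv ?_
  ext h
  have hproj : ∀ p, (EuclideanSpace.proj p : EuclideanSpace ℝ (S × A) →L[ℝ] ℝ) h = h p :=
    fun _ => rfl
  simp only [smul_apply, sub_apply, add_apply, sum_apply, smul_eq_mul, hproj, Function.comp_apply]
  have h1 : ∑ a', Real.exp (θ (s, a')) * (∑ a', Real.exp (θ (s, a')))⁻¹ * h (s, a') =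
      (∑ a', Real.exp (θ (s, a')))⁻¹ * ∑ a', Real.exp (θ (s, a')) * h (s, a') := by
    rw [Finset.mul_sum]; exact Finset.sum_congr rfl fun _ _ => by ring
  rw [h1]
  field_simp
  ring

lemma continuous_softmaxPolicy (s : S) (a : A) :
    Continuous fun ϑ : EuclideanSpace ℝ (S × A) => softmaxPolicy ϑ s a :=
  continuous_iff_continuousAt.2 fun θ => (hasFDerivAt_softmaxPolicy θ s a).continuousAt

end Softmax

/-- Since `f y - f x` is `O(y - x)`, replacing `q y` by `q x` costs only `o(y - x)`; no derivative
of `q` is needed. -/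
lemma HasFDerivAt.sub_const_mul_of_continuousAt {E : Type*} [NormedAddCommGroup E]
    [NormedSpace ℝ E] {f q : E → ℝ} {f' : E →L[ℝ] ℝ} {x : E} (hf : HasFDerivAt f f' x)
    (hq : ContinuousAt q x) :
    HasFDerivAt (fun y => (f y - f x) * q y) (q x • f') x := by
  rw [hasFDerivAt_iff_isLittleO]
  have h1 : (fun y => (f y - f x) * (q y - q x)) =o[𝓝 x] fun y => y - x := by
    have hq' : (fun y => q y - q x) =o[𝓝 x] fun _ => (1 : ℝ) :=
      (Asymptotics.isLittleO_one_iff ℝ).2 (tendsto_sub_nhds_zero_iff.2 hq)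
    have := hf.isBigO_sub.norm_right.mul_isLittleO hq'
    simp only [mul_one] at this
    exact this.of_norm_right
  refine (h1.add (hf.isLittleO.const_mul_left (q x))).congr_left fun y => ?_
  simp only [smul_apply, smul_eq_mul]
  ring

/-! ### The policy gradient theorem -/

namespace FiniteMDP

section Gradient

variable {S A : Type*} [Fintype S] [Fintype A] [Nonempty A] {M : FiniteMDP S A}

/-- The difference of values solves a discounted equation whose source is at most `c θ`, a
continuous function vanishing at `θ₀` because the advantages average to zero under `π₀`. -/
lemma V_softmax_continuous (s : S) :
    Continuous fun θ : EuclideanSpace ℝ (S × A) => M.V (softmaxPolicy θ) s := by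
  refine continuous_iff_continuousAt.2 fun θ₀ => ?_
  have hm := fun θ : EuclideanSpace ℝ (S × A) => softmaxPolicy_mem θ
  set π₀ := softmaxPolicy θ₀
  set c : EuclideanSpace ℝ (S × A) → ℝ :=
    fun θ => ∑ s, |∑ a, softmaxPolicy θ s a * M.adv π₀ s a| with hc
  have hc_cont : Continuous c := continuous_finsetSum _ fun s _ =>
    (continuous_finsetSum _ fun a _ => (continuous_softmaxPolicy s a).mul continuous_const).abs
  have hc0 : c θ₀ = 0 := Finset.sum_eq_zero fun s _ => by
    have := sum_advHat (M := M) (hm θ₀) s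
    simp only [advHat] at this
    rw [this, abs_zero]
  have hle : ∀ θ s, |∑ a, softmaxPolicy θ s a * M.adv π₀ s a| ≤ c θ := fun θ s =>
    Finset.single_le_sum (f := fun s => |∑ a, softmaxPolicy θ s a * M.adv π₀ s a|)
      (fun _ _ => abs_nonneg _) (Finset.mem_univ s)
  have hbound : ∀ θ, |M.V (softmaxPolicy θ) s - M.V π₀ s| ≤ c θ / (1 - M.γ) := fun θ => by
    refine abs_le.2 ⟨?_, ?_⟩
    · have := le_div_of_le_add_discounted (M := M) (hm θ) (c := c θ)
        (g := fun s => -(M.V (softmaxPolicy θ) s - M.V π₀ s)) (fun s => by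
          rw [V_sub_V_eq (M := M) (hm θ₀) (hm θ) s]
          simp only [mul_neg, Finset.sum_neg_distrib]
          linarith [neg_abs_le (∑ a, softmaxPolicy θ s a * M.adv π₀ s a), hle θ s]) s
      linarith
    · exact le_div_of_le_add_discounted (M := M) (hm θ) (c := c θ)
        (g := fun s => M.V (softmaxPolicy θ) s - M.V π₀ s) (fun s => by
          rw [V_sub_V_eq (M := M) (hm θ₀) (hm θ) s]
          linarith [le_abs_self (∑ a, softmaxPolicy θ s a * M.adv π₀ s a), hle θ s]) s
  have hlim : Tendsto (fun θ => c θ / (1 - M.γ)) (𝓝 θ₀) (𝓝 0) := by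
    have := (hc_cont.div_const (1 - M.γ)).tendsto θ₀
    rwa [hc0, zero_div] at this
  exact tendsto_sub_nhds_zero_iff.1 (squeeze_zero_norm hbound hlim)

lemma Q_softmax_continuous (s : S) (a : A) :
    Continuous fun θ : EuclideanSpace ℝ (S × A) => M.Q (softmaxPolicy θ) s a := by
  have h : (fun θ : EuclideanSpace ℝ (S × A) => M.Q (softmaxPolicy θ) s a) =
      fun θ => M.r s a + M.γ * ∑ s', M.P s a s' * M.V (softmaxPolicy θ) s' :=
    funext fun θ => Q_eq (softmaxPolicy_mem θ) s a
  rw [h]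
  exact continuous_const.add (continuous_const.mul (continuous_finsetSum _ fun s' _ =>
    continuous_const.mul (V_softmax_continuous s')))

/-- The policy gradient theorem for the softmax parametrization. -/
theorem hasGradientAt_valueAt_softmaxPolicy {μ : S → ℝ} (hμ : ∀ s, 0 ≤ μ s)
    (θ : EuclideanSpace ℝ (S × A)) :
    HasGradientAt (fun ϑ => M.valueAt (softmaxPolicy ϑ) μ)
      (WithLp.toLp 2 fun p : S × A => M.stateOccupancy (softmaxPolicy θ) μ p.1 *
        M.advHat (softmaxPolicy θ) p.1 p.2) θ := by
  rw [hasGradientAt_iff_hasFDerivAt]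
  have hm := fun θ : EuclideanSpace ℝ (S × A) => softmaxPolicy_mem θ
  -- The performance difference lemma is used with the base point `θ` as the comparison policy. The
  -- occupancy is then constant in `ϑ`, and the varying `Q` multiplies a factor vanishing at `θ`, so
  -- its continuity suffices.
  have heq : (fun ϑ => M.valueAt (softmaxPolicy ϑ) μ) = fun ϑ =>
      M.valueAt (softmaxPolicy θ) μ + ∑ s, M.stateOccupancy (softmaxPolicy θ) μ s *
        ∑ a, (softmaxPolicy ϑ s a - softmaxPolicy θ s a) * M.Q (softmaxPolicy ϑ) s a := by
    funext ϑ
    have h := valueAt_sub_valueAt (M := M) (hm ϑ) (hm θ) hμ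
    have h2 : ∀ s, ∑ a, (softmaxPolicy ϑ s a - softmaxPolicy θ s a) * M.Q (softmaxPolicy ϑ) s a =
        -∑ a, softmaxPolicy θ s a * M.adv (softmaxPolicy ϑ) s a := fun s => by
      rw [sum_mul_adv, policy_sum (hm θ), one_mul, V_eq (hm ϑ)]
      simp only [sub_mul, Finset.sum_sub_distrib]
      ring
    simp only [h2, mul_neg, Finset.sum_neg_distrib]
    linarith
  rw [heq]
  have hd := (HasFDerivAt.fun_sum (u := Finset.univ) fun s _ =>
    (HasFDerivAt.fun_sum (u := Finset.univ) fun a _ =>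
      (hasFDerivAt_softmaxPolicy θ s a).sub_const_mul_of_continuousAt
        (Q_softmax_continuous (M := M) s a).continuousAt).const_mul
          (M.stateOccupancy (softmaxPolicy θ) μ s)).const_add (M.valueAt (softmaxPolicy θ) μ)
  refine hd.congr_fderiv ?_
  ext h
  have hproj : ∀ p, (EuclideanSpace.proj p : EuclideanSpace ℝ (S × A) →L[ℝ] ℝ) h = h p :=
    fun _ => rfl
  simp only [smul_apply, sub_apply, sum_apply, smul_eq_mul, InnerProductSpace.toDual_apply_apply,
    hproj, PiLp.inner_apply, Fintype.sum_prod_type, RCLike.inner_apply,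
    conj_trivial]
  refine Finset.sum_congr rfl fun s _ => ?_
  simp only [advHat, adv, V_eq (M := M) (hm θ) s]
  have h1 : ∑ a, M.Q (softmaxPolicy θ) s a * (softmaxPolicy θ s a *
      (h (s, a) - ∑ a', softmaxPolicy θ s a' * h (s, a'))) =
      ∑ a, M.Q (softmaxPolicy θ) s a * softmaxPolicy θ s a * h (s, a) -
        (∑ a, softmaxPolicy θ s a * M.Q (softmaxPolicy θ) s a) *
          ∑ a', softmaxPolicy θ s a' * h (s, a') := by
    rw [Finset.sum_mul, ← Finset.sum_sub_distrib]
    exact Finset.sum_congr rfl fun a _ => by ring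
  rw [h1, Finset.mul_sum, ← Finset.sum_sub_distrib, Finset.mul_sum]
  exact Finset.sum_congr rfl fun a _ => by ring

end Gradient
end FiniteMDP

/-! ### Improvement in one multiplicative-weights step -/

section SoftmaxStep

variable {A : Type*} [Fintype A]

lemma mul_exp_sub_one_nonneg {h y : ℝ} (hh : 0 ≤ h) : 0 ≤ y * (Real.exp (h * y) - 1) := by
  rcases le_total 0 y with hy | hy
  · exact mul_nonneg hy (sub_nonneg.2 (Real.one_le_exp (mul_nonneg hh hy)))
  · exact mul_nonneg_of_nonpos_of_nonpos hy
      (sub_nonpos.2 (Real.exp_le_one_iff.2 (mul_nonpos_of_nonneg_of_nonpos hh hy)))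

/-- In a family with sum zero, the maximum is at least `1 / |A|` times any modulus. -/
lemma exists_abs_div_card_le {y : A → ℝ} (hy : ∑ a, y a = 0) (a₀ : A) :
    ∃ a₁, (∀ a, y a ≤ y a₁) ∧ |y a₀| / Fintype.card A ≤ y a₁ := by
  classical
  have : Nonempty A := ⟨a₀⟩
  obtain ⟨a₁, -, h₁⟩ := Finset.exists_max_image Finset.univ y Finset.univ_nonempty
  have h₁ : ∀ a, y a ≤ y a₁ := fun a => h₁ a (Finset.mem_univ a)
  refine ⟨a₁, h₁, ?_⟩
  have hcard : (0 : ℝ) < Fintype.card A := Nat.cast_pos.2 Fintype.card_pos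
  have hm0 : 0 ≤ y a₁ := by
    have : ∑ a, y a ≤ ∑ _a : A, y a₁ := Finset.sum_le_sum fun a _ => h₁ a
    rw [hy, Finset.sum_const, Finset.card_univ, nsmul_eq_mul] at this
    exact nonneg_of_mul_nonneg_right this hcard
  rw [div_le_iff₀ hcard, abs_le']
  constructor
  · calc y a₀ ≤ y a₁ * 1 := by rw [mul_one]; exact h₁ a₀
      _ ≤ _ := mul_le_mul_of_nonneg_left (by exact_mod_cast Fintype.card_pos) hm0
  · have h2 : ∑ a ∈ Finset.univ.erase a₀, y a = -y a₀ := by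
      rw [← Finset.add_sum_erase _ _ (Finset.mem_univ a₀)] at hy; linarith
    rw [← h2]
    calc _ ≤ ∑ a ∈ Finset.univ.erase a₀, y a₁ := Finset.sum_le_sum fun a _ => h₁ a
      _ ≤ ∑ _a : A, y a₁ := Finset.sum_le_sum_of_subset_of_nonneg (Finset.erase_subset _ _)
          fun _ _ _ => hm0
      _ = _ := by rw [Finset.sum_const, Finset.card_univ, nsmul_eq_mul, mul_comm]

/-- One-step improvement of a multiplicative-weights update: if `p` is a distribution and
`∑ p x = 0`, then reweighting by `exp (h * p * x)` raises the mean of `x` by at least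
`1 / |A| * (1 - 1 / (c + 1))` times the maximal `|p a * x a|`, if `c ≤ h * max |p a * x a|`. -/
lemma softmax_step_improvement {p x p' : A → ℝ} {h c : ℝ} (hp : ∀ a, 0 ≤ p a)
    (hp1 : ∑ a, p a = 1) (hx : ∑ a, p a * x a = 0) (hh : 0 ≤ h) (hc : 0 ≤ c)
    (hp' : ∀ a, p' a = p a * Real.exp (h * (p a * x a)) /
      ∑ a, p a * Real.exp (h * (p a * x a)))
    (hZ : 0 < ∑ a, p a * Real.exp (h * (p a * x a)))
    (a₀ : A) (ha₀ : ∀ a, |p a * x a| ≤ |p a₀ * x a₀|) (hca : c ≤ h * |p a₀ * x a₀|) :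
    |p a₀ * x a₀| / Fintype.card A * (1 - 1 / (c + 1)) ≤ ∑ a, p' a * x a := by
  obtain ⟨a₁, h₁, hdiv⟩ := exists_abs_div_card_le hx a₀
  have : Nonempty A := ⟨a₀⟩
  set y : A → ℝ := fun a => p a * x a with hy
  set m := y a₁
  set X := |y a₀| with hX
  have hcard : (1 : ℝ) ≤ Fintype.card A := by exact_mod_cast Fintype.card_pos (α := A)
  have hm0 : 0 ≤ m := (div_nonneg (abs_nonneg _) (by linarith)).trans hdiv
  -- Subtracting `∑ a, y a = 0` makes every term of the numerator nonnegative, so any terms may be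
  -- discarded.
  have hmean : ∑ a, p' a * x a =
      (∑ a, y a * (Real.exp (h * y a) - 1)) / ∑ a, p a * Real.exp (h * y a) := by
    have : ∑ a, y a * (Real.exp (h * y a) - 1) = ∑ a, y a * Real.exp (h * y a) := by
      simp only [mul_sub, mul_one, Finset.sum_sub_distrib]
      rw [show ∑ a, y a = 0 from hx, sub_zero]
    rw [this, Finset.sum_div]
    refine Finset.sum_congr rfl fun a _ => ?_
    rw [hp' a]
    simp only [hy]
    ring
  have hc1 : 1 - 1 / (c + 1) = c / (c + 1) := by field_simp; ring
  have hfrac : 0 ≤ 1 - 1 / (c + 1) := by rw [hc1]; positivity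
  have hle1 : 1 - 1 / (c + 1) ≤ 1 := by
    have : 0 ≤ 1 / (c + 1) := by positivity
    linarith
  have hZle : ∑ a, p a * Real.exp (h * y a) ≤ Real.exp (h * m) := by
    calc _ ≤ ∑ a, p a * Real.exp (h * m) := Finset.sum_le_sum fun a _ =>
          mul_le_mul_of_nonneg_left (Real.exp_le_exp.2 (mul_le_mul_of_nonneg_left (h₁ a) hh))
            (hp a)
      _ = _ := by rw [← Finset.sum_mul, hp1, one_mul]
  have hnn : ∀ a, 0 ≤ y a * (Real.exp (h * y a) - 1) := fun a => mul_exp_sub_one_nonneg hh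
  have hD : 0 ≤ X / Fintype.card A * (1 - 1 / (c + 1)) :=
    mul_nonneg (div_nonneg (abs_nonneg _) (by linarith)) hfrac
  rw [hmean, le_div_iff₀ hZ]
  refine (mul_le_mul_of_nonneg_left hZle hD).trans ?_
  have hexp1 : 1 ≤ Real.exp (h * m) := Real.one_le_exp (mul_nonneg hh hm0)
  have hXdiv : X / Fintype.card A ≤ X := div_le_self (abs_nonneg _) hcard
  -- The rate factor comes from `exp (h * X) ≥ 1 + h * X ≥ 1 + c`.
  have hfac : 1 - 1 / (c + 1) ≤ 1 - Real.exp (-(h * X)) := by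
    have h2 : c + 1 ≤ Real.exp (h * X) := by linarith [Real.add_one_le_exp (h * X)]
    rw [Real.exp_neg, ← one_div]
    exact sub_le_sub_left (one_div_le_one_div_of_le (by linarith) h2) _
  rcases le_total 0 (y a₀) with h0 | h0
  -- If the largest modulus is attained at a nonnegative entry, the term at `a₁` alone suffices.
  · have hXm : X = m := le_antisymm (by rw [hX, abs_of_nonneg h0]; exact h₁ a₀)
      ((le_abs_self _).trans (ha₀ a₁))
    have hstep : m * (Real.exp (h * m) - 1) ≤ ∑ a, y a * (Real.exp (h * y a) - 1) :=
      Finset.single_le_sum (f := fun a => y a * (Real.exp (h * y a) - 1))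
        (fun a _ => hnn a) (Finset.mem_univ a₁)
    refine le_trans ?_ hstep
    rw [hXm] at hfac hXdiv ⊢
    have e : Real.exp (-(h * m)) * Real.exp (h * m) = 1 := by rw [← Real.exp_add]; simp
    calc _ ≤ m * (1 - Real.exp (-(h * m))) * Real.exp (h * m) :=
          mul_le_mul_of_nonneg_right (mul_le_mul hXdiv hfac hfrac hm0) (by positivity)
      _ = _ := by rw [mul_assoc, sub_mul, e, one_mul]
  · rcases eq_or_ne a₀ a₁ with rfl | hne
    · have hX0 : X = 0 := by rw [hX, le_antisymm h0 hm0, abs_zero]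
      rw [hX0, zero_div, zero_mul, zero_mul]
      exact Finset.sum_nonneg fun a _ => hnn a
    -- Otherwise the terms at `a₀` and `a₁` are kept. With `D` the claimed gain, they are at least
    -- `D` and `D * (exp (h * m) - 1)`, which add up to `D * exp (h * m)`.
    have hstep : X * (1 - Real.exp (-(h * X))) + m * (Real.exp (h * m) - 1) ≤
        ∑ a, y a * (Real.exp (h * y a) - 1) := by
      classical
      have e : X * (1 - Real.exp (-(h * X))) = y a₀ * (Real.exp (h * y a₀) - 1) := by
        rw [hX, abs_of_nonpos h0]
        simp only [mul_neg, neg_neg]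
        ring
      rw [e, ← Finset.sum_pair (f := fun a => y a * (Real.exp (h * y a) - 1)) hne]
      exact Finset.sum_le_sum_of_subset_of_nonneg (Finset.subset_univ _) fun a _ _ => hnn a
    refine le_trans ?_ hstep
    have t1 : X / Fintype.card A * (1 - 1 / (c + 1)) ≤ X * (1 - Real.exp (-(h * X))) :=
      mul_le_mul hXdiv hfac hfrac (abs_nonneg _)
    have t2 : X / Fintype.card A * (1 - 1 / (c + 1)) ≤ m :=
      (mul_le_of_le_one_right (div_nonneg (abs_nonneg _) (by linarith)) hle1).trans hdiv
    nlinarith [mul_le_mul_of_nonneg_right t2 (sub_nonneg.2 hexp1)]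

end SoftmaxStep

/-- For negative `q` the nonnegative sequence must vanish identically, so no sign of the contraction
factor has to be checked. -/
lemma le_pow_mul_of_succ_le_mul {x : ℕ → ℝ} {q : ℝ} (hx : ∀ k, 0 ≤ x k)
    (h : ∀ k, x (k + 1) ≤ q * x k) (k : ℕ) : x k ≤ q ^ k * x 0 := by
  rcases le_or_gt 0 q with hq | hq
  · induction k with
    | zero => simp
    | succ k ih =>
      calc x (k + 1) ≤ q * x k := h k
        _ ≤ q * (q ^ k * x 0) := mul_le_mul_of_nonneg_left ih hq
        _ = _ := by ring
  · have h0 : ∀ k, x k = 0 := fun k => by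
      have := (hx (k + 1)).trans (h k)
      nlinarith [hx k]
    simp [h0]

/-! ### Advantageous actions keep their probability -/

section SoftmaxDynamics

variable {A : Type*} [Fintype A]

/-- Along the softmax dynamics `θ ← θ + h p x` with bounded, `p`-centred `x`, an action whose `x`
stays above a positive constant keeps a probability bounded away from zero. -/
lemma exists_pos_eventually_le_softmax {θ p x : ℕ → A → ℝ} {h : ℕ → ℝ} {B δ : ℝ} {K : ℕ} {a₀ : A}
    (hp : ∀ k a, p k a = Real.exp (θ k a) / ∑ a', Real.exp (θ k a'))
    (hh : ∀ k, 0 ≤ h k) (hθ : ∀ k a, θ (k + 1) a = θ k a + h k * (p k a * x k a))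
    (hsum : ∀ k, ∑ a, p k a * x k a = 0) (hB : ∀ k a, |x k a| ≤ B) (hδ : 0 < δ)
    (hx : ∀ k, K ≤ k → δ ≤ x k a₀) :
    ∃ c > 0, ∀ᶠ k in atTop, c ≤ p k a₀ := by
  classical
  have : Nonempty A := ⟨a₀⟩
  obtain ⟨n, hn_def⟩ : ∃ n : ℝ, n = Fintype.card A := ⟨_, rfl⟩
  have hn : 1 ≤ n := by rw [hn_def]; exact_mod_cast Fintype.card_pos (α := A)
  have hZ : ∀ k, 0 < ∑ a', Real.exp (θ k a') := fun k =>
    Finset.sum_pos (fun _ _ => Real.exp_pos _) Finset.univ_nonempty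
  have hp0 : ∀ k a, 0 ≤ p k a := fun k a => by
    rw [hp]; exact div_nonneg (Real.exp_pos _).le (hZ k).le
  have hBδ : δ ≤ B := (hx K le_rfl).trans ((le_abs_self _).trans (hB K a₀))
  have hBpos : 0 < B := hδ.trans_le hBδ
  -- Chosen so that an action with `p k a ≤ ε * p k a₀` moves, up or down, by at most a fraction `1
  -- / n` of the increase of the logit of `a₀`.
  set ε := δ / (n * B) with hε_def
  have hε : 0 < ε := by positivity
  have hε1 : ε ≤ 1 := by
    rw [hε_def, div_le_one (by positivity)]
    nlinarith
  have hlog : Real.log ε ≤ 0 := Real.log_nonpos hε.le hε1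
  have hy0 : ∀ k, K ≤ k → 0 ≤ p k a₀ * x k a₀ := fun k hk =>
    mul_nonneg (hp0 _ _) (hδ.le.trans (hx k hk))
  have hdom : ∀ k a, K ≤ k → θ k a ≤ θ k a₀ + Real.log ε →
      |p k a * x k a| ≤ p k a₀ * x k a₀ / n := by
    intro k a hk ha
    have h1 : p k a ≤ ε * p k a₀ := by
      rw [hp, hp, ← mul_div_assoc]
      refine div_le_div_of_nonneg_right ?_ (hZ k).le
      calc Real.exp (θ k a) ≤ Real.exp (θ k a₀ + Real.log ε) := Real.exp_le_exp.2 ha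
        _ = _ := by rw [Real.exp_add, Real.exp_log hε, mul_comm]
    calc |p k a * x k a| = p k a * |x k a| := by rw [abs_mul, abs_of_nonneg (hp0 k a)]
      _ ≤ (ε * p k a₀) * B := mul_le_mul h1 (hB k a) (abs_nonneg _)
          (mul_nonneg hε.le (hp0 _ _))
      _ = p k a₀ * δ / n := by rw [hε_def]; field_simp
      _ ≤ _ := div_le_div_of_nonneg_right (mul_le_mul_of_nonneg_left (hx k hk) (hp0 _ _))
          (by linarith)
  have hdom_succ : ∀ k a, K ≤ k → θ k a ≤ θ k a₀ + Real.log ε →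
      θ (k + 1) a ≤ θ (k + 1) a₀ + Real.log ε := by
    intro k a hk ha
    have h1 : p k a * x k a ≤ p k a₀ * x k a₀ :=
      (le_abs_self _).trans ((hdom k a hk ha).trans (div_le_self (hy0 k hk) hn))
    rw [hθ, hθ]
    linarith [mul_le_mul_of_nonneg_left h1 (hh k)]
  have hdom_mono : ∀ a k l, K ≤ k → k ≤ l → θ k a ≤ θ k a₀ + Real.log ε →
      θ l a ≤ θ l a₀ + Real.log ε := by
    intro a k l hk hkl hka
    induction l, hkl using Nat.le_induction with
    | base => exact hka
    | succ l hl ih => exact hdom_succ l a (hk.trans hl) ih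
  -- The actions dominated by `a₀` at some time after `K`, hence forever after.
  set D : Finset A := {a | a ≠ a₀ ∧ ∃ k, K ≤ k ∧ θ k a ≤ θ k a₀ + Real.log ε} with hD
  have hev : ∀ᶠ k in atTop, ∀ a ∈ D, θ k a ≤ θ k a₀ + Real.log ε := by
    rw [Filter.eventually_all_finset]
    intro a ha
    obtain ⟨-, k, hk, hka⟩ := (Finset.mem_filter.1 ha).2
    exact eventually_atTop.2 ⟨k, fun l hl => hdom_mono a k l hk hl hka⟩
  obtain ⟨N, hN⟩ := eventually_atTop.1 (hev.and (eventually_ge_atTop K))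
  have hKN : ∀ k, N ≤ k → K ≤ k := fun k hk => (hN k hk).2
  -- The logits in `D` together lose no more than `a₀` gains, so `G` is nondecreasing from time `N`
  -- on.
  set G : ℕ → ℝ := fun k => ∑ a ∈ D, θ k a + θ k a₀ with hG
  have hGmono : ∀ k, N ≤ k → G N ≤ G k := by
    intro k hk
    induction k, hk using Nat.le_induction with
    | base => exact le_rfl
    | succ k hk ih =>
      refine ih.trans ?_
      have h1 : -(p k a₀ * x k a₀) ≤ ∑ a ∈ D, p k a * x k a := by
        calc -(p k a₀ * x k a₀) = ∑ _a : A, -(p k a₀ * x k a₀ / n) := by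
              rw [Finset.sum_const, Finset.card_univ, nsmul_eq_mul, ← hn_def]
              field_simp
          _ ≤ ∑ _a ∈ D, -(p k a₀ * x k a₀ / n) := by
              rw [Finset.sum_neg_distrib, Finset.sum_neg_distrib, neg_le_neg_iff]
              exact Finset.sum_le_sum_of_subset_of_nonneg (Finset.subset_univ _)
                fun _ _ _ => div_nonneg (hy0 k (hKN k hk)) (by linarith)
          _ ≤ _ := Finset.sum_le_sum fun a ha =>
              (abs_le.1 (hdom k a (hKN k hk) ((hN k hk).1 a ha))).1
      simp only [hG, hθ, Finset.sum_add_distrib, ← Finset.mul_sum]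
      nlinarith [hh k]
  have hmono₀ : ∀ k, N ≤ k → θ N a₀ ≤ θ k a₀ := by
    intro k hk
    induction k, hk using Nat.le_induction with
    | base => exact le_rfl
    | succ k hk ih =>
      rw [hθ]
      linarith [mul_nonneg (hh k) (hy0 k (hKN k hk))]
  have htotal : ∀ k, ∑ a, θ k a = ∑ a, θ 0 a := by
    intro k
    induction k with
    | zero => rfl
    | succ k ih => simp only [hθ, Finset.sum_add_distrib, ← Finset.mul_sum, hsum, mul_zero,
        add_zero, ih]
  set m := θ N a₀ + Real.log ε with hm
  -- Logits in `E` are never dominated after `K`, so they stay above `m` from time `N` on. The total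
  -- of all logits is conserved and `G` does not decrease, so their sum is bounded above, and hence
  -- so is each of them.
  set E : Finset A := Finset.univ \ insert a₀ D with hE
  have ha₀D : a₀ ∉ D := by simp [hD]
  have hEm : ∀ k, N ≤ k → ∀ a ∈ E, 0 ≤ θ k a - m := by
    intro k hk a ha
    have ha' : a ≠ a₀ ∧ a ∉ D := by
      simpa [hE, not_or] using ha
    by_contra hlt
    refine ha'.2 ?_
    simp only [hD, Finset.mem_filter, Finset.mem_univ, true_and]
    exact ⟨ha'.1, k, hKN k hk, by linarith [hmono₀ k hk]⟩
  set U := ∑ a, θ 0 a - G N - ∑ _a ∈ E, m with hU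
  have hEU : ∀ k, N ≤ k → ∀ a ∈ E, θ k a ≤ U + m := by
    intro k hk a ha
    have h1 := Finset.single_le_sum (f := fun a => θ k a - m) (hEm k hk) ha
    have h2 : ∑ a ∈ E, θ k a + G k = ∑ a, θ 0 a := by
      rw [← htotal k, ← Finset.sum_sdiff (Finset.subset_univ (insert a₀ D)),
        Finset.sum_insert ha₀D, hG]
      ring
    rw [Finset.sum_sub_distrib] at h1
    have h3 := hGmono k hk
    rw [hU]
    linarith
  set W := max (U + Real.log ε) 0 with hW
  have hdiff : ∀ k, N ≤ k → ∀ a, θ k a ≤ θ k a₀ + W := by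
    intro k hk a
    have hW0 : 0 ≤ W := le_max_right _ _
    by_cases haE : a ∈ E
    · linarith [hEU k hk a haE, hmono₀ k hk, le_max_left (U + Real.log ε) 0]
    · have : a = a₀ ∨ a ∈ D := by simpa [hE, or_iff_not_imp_left] using haE
      rcases this with rfl | haD
      · linarith
      · linarith [(hN k hk).1 a haD]
  refine ⟨1 / (n * Real.exp W), by positivity, eventually_atTop.2 ⟨N, fun k hk => ?_⟩⟩
  rw [hp, div_le_div_iff₀ (by positivity) (hZ k), one_mul]
  calc ∑ a, Real.exp (θ k a) ≤ ∑ _a : A, Real.exp (θ k a₀ + W) :=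
        Finset.sum_le_sum fun a _ => Real.exp_le_exp.2 (hdiff k hk a)
    _ = Real.exp (θ k a₀) * (n * Real.exp W) := by
        rw [Finset.sum_const, Finset.card_univ, nsmul_eq_mul, ← hn_def, Real.exp_add]
        ring

end SoftmaxDynamics

/-! ### Convergence of the iterates to the optimal value -/

namespace FiniteMDP

section Dynamics

set_option linter.unusedSectionVars false

variable {S A : Type*} [Fintype S] [Fintype A] [Nonempty A] {M : FiniteMDP S A}

variable (M) in
/-- `max_a |Â^π(s, a)|`. -/
noncomputable def advHatSup (π : S → A → ℝ) (s : S) : ℝ := ⨆ a, |M.advHat π s a|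

lemma abs_advHat_le_advHatSup (π : S → A → ℝ) (s : S) (a : A) :
    |M.advHat π s a| ≤ M.advHatSup π s :=
  le_ciSup (f := fun a => |M.advHat π s a|) (Set.finite_range _).bddAbove a

lemma exists_abs_advHat_eq (π : S → A → ℝ) (s : S) :
    ∃ a, |M.advHat π s a| = M.advHatSup π s :=
  exists_eq_ciSup_of_finite

lemma advHatSup_nonneg (π : S → A → ℝ) (s : S) : 0 ≤ M.advHatSup π s :=
  Real.iSup_nonneg fun _ => abs_nonneg _

/-- The `Â` at a state sum to zero, so a nonzero one forces a positive one. -/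
lemma activeStates_eq {π : S → A → ℝ} (hπ : π ∈ policies S A) :
    M.activeStates π = {s | 0 < ⨆ a, M.advHat π s a} := by
  ext s
  obtain ⟨a₀, h₀⟩ := exists_abs_advHat_eq (M := M) π s
  change 0 < M.advHatSup π s ↔ 0 < ⨆ a, M.advHat π s a
  have hbdd : BddAbove (Set.range fun a => M.advHat π s a) := (Set.finite_range _).bddAbove
  constructor
  · intro h
    obtain ⟨a₁, -, h₁⟩ := exists_abs_div_card_le (sum_advHat hπ s) a₀
    rw [h₀] at h₁
    exact (div_pos h (Nat.cast_pos.2 Fintype.card_pos)).trans_le (h₁.trans (le_ciSup hbdd a₁))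
  · intro h
    exact h.trans_le (ciSup_mono (Set.finite_range _).bddAbove fun a => le_abs_self _)

variable (M) in
/-- Softmax dynamics with a state-dependent step size `h k s`, which at the active states is at
least `c` times the inverse of `max_a |Â(s, a)|`. -/
structure SoftmaxDynamics (θ : ℕ → EuclideanSpace ℝ (S × A)) (c : ℝ) (h : ℕ → S → ℝ) :
    Prop where
  nonneg : ∀ k s, 0 ≤ h k s
  step : ∀ k s a, θ (k + 1) (s, a) =
    θ k (s, a) + h k s * M.advHat (softmaxPolicy (θ k)) s a
  large : ∀ k s, 0 < M.advHatSup (softmaxPolicy (θ k)) s →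
    c ≤ h k s * M.advHatSup (softmaxPolicy (θ k)) s

lemma IsSoftmaxPG.exists_softmaxDynamics {μ : S → ℝ} {η : ℕ → ℝ}
    {θ : ℕ → EuclideanSpace ℝ (S × A)} (hθ : M.IsSoftmaxPG μ η θ) {C : ℝ} (hC : 0 < C)
    (hμ : 0 < ⨅ s, μ s)
    (hη : ∀ k, (M.activeStates (softmaxPolicy (θ k))).Nonempty →
      C / (⨅ s : M.activeStates (softmaxPolicy (θ k)),
        ⨆ a, |M.advHat (softmaxPolicy (θ k)) s a|) ≤ η k) :
    ∃ h, M.SoftmaxDynamics θ (C * ⨅ s, μ s) h := by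
  have hμle : ∀ s, ⨅ s, μ s ≤ μ s := ciInf_le (Set.finite_range _).bddBelow
  have hμ0 : ∀ s, 0 ≤ μ s := fun s => hμ.le.trans (hμle s)
  have hη' : ∀ k s, 0 < M.advHatSup (softmaxPolicy (θ k)) s →
      0 ≤ η k ∧ C ≤ η k * M.advHatSup (softmaxPolicy (θ k)) s := by
    intro k s hs
    have hne : (M.activeStates (softmaxPolicy (θ k))).Nonempty := ⟨s, hs⟩
    have hne' := hne.to_subtype
    have h1 := hη k hne
    set m := ⨅ s : M.activeStates (softmaxPolicy (θ k)),
      ⨆ a, |M.advHat (softmaxPolicy (θ k)) s a| with hm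
    have hmpos : 0 < m := by
      obtain ⟨s', hs'⟩ := exists_eq_ciInf_of_finite
        (f := fun s : M.activeStates (softmaxPolicy (θ k)) =>
          ⨆ a, |M.advHat (softmaxPolicy (θ k)) s a|)
      rw [hm, ← hs']
      exact s'.2
    have hmle : m ≤ M.advHatSup (softmaxPolicy (θ k)) s :=
      ciInf_le (f := fun s : M.activeStates (softmaxPolicy (θ k)) =>
        ⨆ a, |M.advHat (softmaxPolicy (θ k)) s a|) (Set.finite_range _).bddBelow ⟨s, hs⟩
    have h0 : 0 ≤ η k := (div_pos hC hmpos).le.trans h1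
    exact ⟨h0, ((div_le_iff₀ hmpos).1 h1).trans (mul_le_mul_of_nonneg_left hmle h0)⟩
  set w := fun k s => M.stateOccupancy (softmaxPolicy (θ k)) μ s with hw
  have hw1 : ∀ k s, ⨅ s, μ s ≤ w k s := fun k s =>
    (hμle s).trans (le_stateOccupancy (softmaxPolicy_mem _) hμ0 s)
  -- At inactive states `Â` vanishes and any step size fits. The value `0` keeps it nonnegative even
  -- when no state is active and `η k` is unconstrained.
  refine ⟨fun k s => if 0 < M.advHatSup (softmaxPolicy (θ k)) s then η k * w k s else 0,
    ⟨fun k s => ?_, fun k s a => ?_, fun k s hs => ?_⟩⟩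
  · split_ifs with hs
    · exact mul_nonneg (hη' k s hs).1 (hμ.le.trans (hw1 k s))
    · exact le_rfl
  · have h1 : θ (k + 1) (s, a) =
        θ k (s, a) + η k * (w k s * M.advHat (softmaxPolicy (θ k)) s a) := by
      rw [hθ k, (hasGradientAt_valueAt_softmaxPolicy hμ0 (θ k)).gradient]
      rfl
    rw [h1]
    split_ifs with hs
    · ring
    · have h2 := (abs_advHat_le_advHatSup (M := M) (softmaxPolicy (θ k)) s a).trans (not_lt.1 hs)
      rw [abs_nonpos_iff.1 h2]
      ring
  · rw [if_pos hs]
    calc C * ⨅ s, μ s ≤ (η k * M.advHatSup (softmaxPolicy (θ k)) s) * w k s :=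
          mul_le_mul (hη' k s hs).2 (hw1 k s) hμ.le
            (hC.le.trans (hη' k s hs).2)
      _ = _ := by ring

variable {θ : ℕ → EuclideanSpace ℝ (S × A)} {c : ℝ} {h : ℕ → S → ℝ}

namespace SoftmaxDynamics

lemma sum_mul_adv_ge (hd : M.SoftmaxDynamics θ c h) (hc : 0 ≤ c) (k : ℕ) (s : S) :
    M.advHatSup (softmaxPolicy (θ k)) s / Fintype.card A * (1 - 1 / (c + 1)) ≤
      ∑ a, softmaxPolicy (θ (k + 1)) s a * M.adv (softmaxPolicy (θ k)) s a := by
  have hm := softmaxPolicy_mem (θ k)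
  obtain ⟨a₀, h₀⟩ := exists_abs_advHat_eq (M := M) (softmaxPolicy (θ k)) s
  have hZ0 := softmaxPolicy_sum_pos (θ k) s
  have hnum : ∀ a, softmaxPolicy (θ k) s a *
      Real.exp (h k s * M.advHat (softmaxPolicy (θ k)) s a) =
        Real.exp (θ (k + 1) (s, a)) / ∑ a', Real.exp (θ k (s, a')) := fun a => by
    rw [hd.step, Real.exp_add, softmaxPolicy]
    ring
  have hp' : ∀ a, softmaxPolicy (θ (k + 1)) s a = softmaxPolicy (θ k) s a *
      Real.exp (h k s * M.advHat (softmaxPolicy (θ k)) s a) /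
        ∑ a, softmaxPolicy (θ k) s a *
          Real.exp (h k s * M.advHat (softmaxPolicy (θ k)) s a) := fun a => by
    simp only [hnum, ← Finset.sum_div]
    rw [div_div_div_cancel_right₀ hZ0.ne']
    rfl
  have hZ : 0 < ∑ a, softmaxPolicy (θ k) s a *
      Real.exp (h k s * M.advHat (softmaxPolicy (θ k)) s a) :=
    Finset.sum_pos (fun a _ => mul_pos (softmaxPolicy_pos _ _ _) (Real.exp_pos _))
      Finset.univ_nonempty
  have key : ∀ c, 0 ≤ c → c ≤ h k s * M.advHatSup (softmaxPolicy (θ k)) s →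
      M.advHatSup (softmaxPolicy (θ k)) s / Fintype.card A * (1 - 1 / (c + 1)) ≤
        ∑ a, softmaxPolicy (θ (k + 1)) s a * M.adv (softmaxPolicy (θ k)) s a := by
    intro c hc hcle
    rw [← h₀] at hcle ⊢
    exact softmax_step_improvement (policy_nonneg hm s) (policy_sum hm s) (sum_advHat hm s)
      (hd.nonneg k s) hc hp' hZ a₀
      (fun a => (abs_advHat_le_advHatSup _ s a).trans_eq h₀.symm) hcle
  -- `large` is silent where the maximum is zero; there the claimed gain is zero and the step lemma
  -- is applied with constant `0`.
  rcases (advHatSup_nonneg (M := M) (softmaxPolicy (θ k)) s).eq_or_lt with h0 | h0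
  · have := key 0 le_rfl (by rw [← h0, mul_zero])
    rw [← h0, zero_div, zero_mul] at this ⊢
    exact this
  · exact key c hc (hd.large k s h0)

lemma gain_nonneg (hc : 0 ≤ c) (π : S → A → ℝ) (s : S) :
    0 ≤ M.advHatSup π s / Fintype.card A * (1 - 1 / (c + 1)) := by
  have h1 : 1 - 1 / (c + 1) = c / (c + 1) := by field_simp; ring
  rw [h1]
  exact mul_nonneg (div_nonneg (advHatSup_nonneg _ _) (Nat.cast_nonneg _)) (by positivity)

lemma gain_le (hd : M.SoftmaxDynamics θ c h) (hc : 0 ≤ c) (k : ℕ) (s : S) :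
    M.advHatSup (softmaxPolicy (θ k)) s / Fintype.card A * (1 - 1 / (c + 1)) ≤
      M.V (softmaxPolicy (θ (k + 1))) s - M.V (softmaxPolicy (θ k)) s :=
  (hd.sum_mul_adv_ge hc k s).trans
    (sum_mul_adv_le_V_sub_V (softmaxPolicy_mem _) (softmaxPolicy_mem _)
      (fun s => (gain_nonneg hc _ s).trans (hd.sum_mul_adv_ge hc k s)) s)

lemma monotone_V (hd : M.SoftmaxDynamics θ c h) (hc : 0 ≤ c) (s : S) :
    Monotone fun k => M.V (softmaxPolicy (θ k)) s :=
  monotone_nat_of_le_succ fun k =>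
    sub_nonneg.1 ((gain_nonneg hc _ s).trans (hd.gain_le hc k s))

lemma exists_tendsto_V (hd : M.SoftmaxDynamics θ c h) (hc : 0 ≤ c) :
    ∃ v : S → ℝ, ∀ s, Tendsto (fun k => M.V (softmaxPolicy (θ k)) s) atTop (𝓝 (v s)) :=
  ⟨_, fun s => tendsto_atTop_ciSup (hd.monotone_V hc s)
    ⟨1 / (1 - M.γ), Set.forall_mem_range.2 fun _ => V_le (softmaxPolicy_mem _) s⟩⟩

/-- The increments of a convergent sequence tend to zero, and they dominate a fixed positive
multiple of `advHatSup`. -/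
lemma tendsto_advHatSup (hd : M.SoftmaxDynamics θ c h) (hc : 0 < c) (s : S) :
    Tendsto (fun k => M.advHatSup (softmaxPolicy (θ k)) s) atTop (𝓝 0) := by
  obtain ⟨v, hv⟩ := hd.exists_tendsto_V hc.le
  have h1 : Tendsto (fun k => M.V (softmaxPolicy (θ (k + 1))) s - M.V (softmaxPolicy (θ k)) s)
      atTop (𝓝 0) := by
    simpa using ((hv s).comp (tendsto_add_atTop_nat 1)).sub (hv s)
  have hcard : (0 : ℝ) < Fintype.card A := Nat.cast_pos.2 Fintype.card_pos
  have h2 : Tendsto (fun k => (M.V (softmaxPolicy (θ (k + 1))) s -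
      M.V (softmaxPolicy (θ k)) s) * (Fintype.card A * ((c + 1) / c))) atTop (𝓝 0) := by
    simpa using h1.mul_const (Fintype.card A * ((c + 1) / c))
  refine squeeze_zero (fun k => advHatSup_nonneg _ _) (fun k => ?_) h2
  calc _ = M.advHatSup (softmaxPolicy (θ k)) s / Fintype.card A * (1 - 1 / (c + 1)) *
        (Fintype.card A * ((c + 1) / c)) := by
          have : 1 - 1 / (c + 1) = c / (c + 1) := by field_simp; ring
          rw [this]
          field_simp
    _ ≤ _ := mul_le_mul_of_nonneg_right (hd.gain_le hc.le k s) (by positivity)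

lemma tendsto_advHat (hd : M.SoftmaxDynamics θ c h) (hc : 0 < c) (s : S) (a : A) :
    Tendsto (fun k => M.advHat (softmaxPolicy (θ k)) s a) atTop (𝓝 0) :=
  squeeze_zero_norm (fun _ => abs_advHat_le_advHatSup _ s a) (hd.tendsto_advHatSup hc s)

lemma tendsto_Q {v : S → ℝ}
    (hv : ∀ s, Tendsto (fun k => M.V (softmaxPolicy (θ k)) s) atTop (𝓝 (v s))) (s : S) (a : A) :
    Tendsto (fun k => M.Q (softmaxPolicy (θ k)) s a) atTop
      (𝓝 (M.r s a + M.γ * ∑ s', M.P s a s' * v s')) := by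
  simp only [Q_eq (M := M) (softmaxPolicy_mem (θ _))]
  exact ((tendsto_finsetSum _ fun s' _ => (hv s').const_mul _).const_mul _).const_add _

/-- A violation is a positive limiting advantage of `a`. Its probability then stays bounded below,
and so does its `Â`, which must tend to zero. -/
lemma limit_bellman (hd : M.SoftmaxDynamics θ c h) (hc : 0 < c) {v : S → ℝ}
    (hv : ∀ s, Tendsto (fun k => M.V (softmaxPolicy (θ k)) s) atTop (𝓝 (v s))) (s : S) (a : A) :
    M.r s a + M.γ * ∑ s', M.P s a s' * v s' ≤ v s := by
  by_contra! hlt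
  set δ := (M.r s a + M.γ * ∑ s', M.P s a s' * v s' - v s) / 2 with hδ_def
  have hδ : 0 < δ := by rw [hδ_def]; linarith
  have hadv : Tendsto (fun k => M.adv (softmaxPolicy (θ k)) s a) atTop (𝓝 (2 * δ)) := by
    have := (tendsto_Q hv s a).sub (hv s)
    rwa [show _ - v s = 2 * δ by rw [hδ_def]; ring] at this
  obtain ⟨K, hK⟩ := eventually_atTop.1 (hadv.eventually_const_le (show δ < 2 * δ by linarith))
  obtain ⟨p₀, hp₀, hev⟩ := exists_pos_eventually_le_softmax
    (θ := fun k a => θ k (s, a)) (p := fun k a => softmaxPolicy (θ k) s a)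
    (x := fun k a => M.adv (softmaxPolicy (θ k)) s a) (h := fun k => h k s)
    (fun k a => rfl) (fun k => hd.nonneg k s) (fun k a => hd.step k s a)
    (fun k => sum_advHat (softmaxPolicy_mem _) s)
    (fun k a => abs_adv_le (softmaxPolicy_mem _) s a) hδ hK
  have hlim := hd.tendsto_advHat hc s a
  have hge : ∀ᶠ k in atTop, p₀ * δ ≤ M.advHat (softmaxPolicy (θ k)) s a := by
    filter_upwards [hev, eventually_ge_atTop K] with k hk hkK
    exact mul_le_mul hk (hK k hkK) hδ.le (hp₀.le.trans hk)
  exact absurd (ge_of_tendsto hlim hge) (not_le.2 (mul_pos hp₀ hδ))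

end SoftmaxDynamics

section Optimality

lemma bddAbove_V (s : S) : BddAbove (Set.range fun π : policies S A => M.V π s) :=
  ⟨1 / (1 - M.γ), Set.forall_mem_range.2 fun π => V_le π.2 s⟩

lemma bddAbove_Q (s : S) (a : A) : BddAbove (Set.range fun π : policies S A => M.Q π s a) :=
  ⟨1 / (1 - M.γ), Set.forall_mem_range.2 fun π => Q_le π.2 s a⟩

lemma V_le_Vstar {π : S → A → ℝ} (hπ : π ∈ policies S A) (s : S) : M.V π s ≤ M.Vstar s :=
  le_ciSup (bddAbove_V (M := M) s) ⟨π, hπ⟩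

lemma nonempty_policies : Nonempty (policies S A) := ⟨⟨_, softmaxPolicy_mem 0⟩⟩

/-- Minimum principle for `v - V^π`. -/
lemma V_le_of_bellman {v : S → ℝ}
    (hv : ∀ s a, M.r s a + M.γ * ∑ s', M.P s a s' * v s' ≤ v s)
    {π : S → A → ℝ} (hπ : π ∈ policies S A) (s : S) : M.V π s ≤ v s := by
  refine sub_nonneg.1 (nonneg_of_discounted_le (M := M) (g := fun s => v s - M.V π s) hπ
    (fun s => ?_) s)
  have h1 : ∑ a, π s a * (M.r s a + M.γ * ∑ s', M.P s a s' * v s') ≤ v s :=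
    calc _ ≤ ∑ a, π s a * v s :=
          Finset.sum_le_sum fun a _ => mul_le_mul_of_nonneg_left (hv s a) (policy_nonneg hπ s a)
      _ = v s := by rw [← Finset.sum_mul, policy_sum hπ, one_mul]
  rw [V_bellman (M := M) hπ s, discounted_sum_comm]
  simp only [mul_add, mul_sub, Finset.sum_add_distrib, Finset.sum_sub_distrib] at h1 ⊢
  linarith

end Optimality

namespace SoftmaxDynamics

lemma tendsto_V (hd : M.SoftmaxDynamics θ c h) (hc : 0 < c) (s : S) :
    Tendsto (fun k => M.V (softmaxPolicy (θ k)) s) atTop (𝓝 (M.Vstar s)) := by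
  obtain ⟨v, hv⟩ := hd.exists_tendsto_V hc.le
  have := nonempty_policies (S := S) (A := A)
  have h1 : M.Vstar s ≤ v s := ciSup_le fun π => V_le_of_bellman (hd.limit_bellman hc hv) π.2 s
  have h2 : v s ≤ M.Vstar s :=
    le_of_tendsto (hv s) (Eventually.of_forall fun k => V_le_Vstar (softmaxPolicy_mem _) s)
  rw [← le_antisymm h2 h1]
  exact hv s

/-- The lower bound comes from the iterates, whose `Q` converges to the right side; the dynamics
thus replace a prior existence proof for an optimal policy. -/
lemma Qstar_eq (hd : M.SoftmaxDynamics θ c h) (hc : 0 < c) (s : S) (a : A) :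
    M.Qstar s a = M.r s a + M.γ * ∑ s', M.P s a s' * M.Vstar s' := by
  have := nonempty_policies (S := S) (A := A)
  refine le_antisymm (ciSup_le fun π => ?_) (le_of_tendsto (tendsto_Q (hd.tendsto_V hc) s a)
    (Eventually.of_forall fun k =>
      le_ciSup (bddAbove_Q (M := M) s a) ⟨_, softmaxPolicy_mem (θ k)⟩))
  rw [Q_eq π.2]
  have : ∑ s', M.P s a s' * M.V π s' ≤ ∑ s', M.P s a s' * M.Vstar s' :=
    Finset.sum_le_sum fun s' _ =>
      mul_le_mul_of_nonneg_left (V_le_Vstar π.2 s') (M.P_nonneg _ _ _)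
  linarith [mul_le_mul_of_nonneg_left this M.γ_nonneg]

lemma tendsto_adv (hd : M.SoftmaxDynamics θ c h) (hc : 0 < c) (s : S) (a : A) :
    Tendsto (fun k => M.adv (softmaxPolicy (θ k)) s a) atTop (𝓝 (M.advStar s a)) := by
  rw [advStar, hd.Qstar_eq hc]
  exact (tendsto_Q (hd.tendsto_V hc) s a).sub (hd.tendsto_V hc s)

lemma advStar_nonpos (hd : M.SoftmaxDynamics θ c h) (hc : 0 < c) (s : S) (a : A) :
    M.advStar s a ≤ 0 := by
  rw [advStar, hd.Qstar_eq hc, sub_nonpos]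
  exact hd.limit_bellman hc (hd.tendsto_V hc) s a

/-- Eventually the probability is the quotient of `Â`, which tends to `0`, by the advantage, whose
limit is nonzero. -/
lemma tendsto_policy_of_advStar_neg (hd : M.SoftmaxDynamics θ c h) (hc : 0 < c) {s : S} {a : A}
    (ha : M.advStar s a < 0) :
    Tendsto (fun k => softmaxPolicy (θ k) s a) atTop (𝓝 0) := by
  have h1 := (hd.tendsto_advHat hc s a).div (hd.tendsto_adv hc s a) ha.ne
  rw [zero_div] at h1
  refine h1.congr' ?_
  filter_upwards [(hd.tendsto_adv hc s a).eventually_lt_const ha] with k hk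
  simp only [Pi.div_apply, advHat]
  exact mul_div_cancel_right₀ _ hk.ne

/-- Otherwise all action probabilities at `s` would tend to zero, although they sum to one. -/
lemma exists_advStar_eq_zero (hd : M.SoftmaxDynamics θ c h) (hc : 0 < c) (s : S) :
    ∃ a, M.advStar s a = 0 := by
  by_contra! hne
  have hlim : Tendsto (fun k => ∑ a, softmaxPolicy (θ k) s a) atTop (𝓝 (∑ _a : A, 0)) :=
    tendsto_finsetSum _ fun a _ =>
      hd.tendsto_policy_of_advStar_neg hc ((hd.advStar_nonpos hc s a).lt_of_ne (hne a))
  simp only [policy_sum (softmaxPolicy_mem (θ _)), Finset.sum_const_zero] at hlim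
  exact one_ne_zero (tendsto_nhds_unique tendsto_const_nhds hlim)

lemma mem_optimalActions_iff (hd : M.SoftmaxDynamics θ c h) (hc : 0 < c) {s : S} {a : A} :
    a ∈ M.optimalActions s ↔ M.advStar s a = 0 := by
  simp only [optimalActions, Finset.mem_filter, Finset.mem_univ, true_and]
  constructor
  · intro ha
    obtain ⟨a', ha'⟩ := hd.exists_advStar_eq_zero hc s
    exact le_antisymm (hd.advStar_nonpos hc s a) (ha' ▸ ha a')
  · intro ha a'
    rw [ha]
    exact hd.advStar_nonpos hc s a'

end SoftmaxDynamics

lemma one_sub_b {π : S → A → ℝ} (hπ : π ∈ policies S A) (s : S) :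
    1 - M.b π s = ∑ a ∈ M.optimalActions s, π s a := by
  classical
  rw [b, ← policy_sum hπ s, sub_eq_iff_eq_add,
    ← Finset.sum_filter_add_sum_filter_not Finset.univ (· ∈ M.optimalActions s)]
  congr 1
  · simp

namespace SoftmaxDynamics

lemma one_sub_b_pos (hd : M.SoftmaxDynamics θ c h) (hc : 0 < c) (k : ℕ) (s : S) :
    0 < 1 - M.b (softmaxPolicy (θ k)) s := by
  rw [one_sub_b (softmaxPolicy_mem _)]
  obtain ⟨a, ha⟩ := hd.exists_advStar_eq_zero hc s
  exact Finset.sum_pos (fun _ _ => softmaxPolicy_pos _ _ _)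
    ⟨a, (hd.mem_optimalActions_iff hc).2 ha⟩

lemma tendsto_one_sub_b (hd : M.SoftmaxDynamics θ c h) (hc : 0 < c) (s : S) :
    Tendsto (fun k => 1 - M.b (softmaxPolicy (θ k)) s) atTop (𝓝 1) := by
  classical
  have : Tendsto (fun k => M.b (softmaxPolicy (θ k)) s) atTop
      (𝓝 (∑ a with a ∉ M.optimalActions s, 0)) := by
    refine tendsto_finsetSum _ fun a ha => hd.tendsto_policy_of_advStar_neg hc ?_
    have ha' := (Finset.mem_filter.1 ha).2
    rw [hd.mem_optimalActions_iff hc] at ha'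
    exact (hd.advStar_nonpos hc s a).lt_of_ne ha'
  simpa using this.const_sub 1

lemma kappa_le (hd : M.SoftmaxDynamics θ c h) (hc : 0 < c) (k : ℕ) (s : S) :
    M.kappa (fun k => softmaxPolicy (θ k)) ≤ 1 - M.b (softmaxPolicy (θ k)) s :=
  ciInf_le (f := fun p : ℕ × S => 1 - M.b (softmaxPolicy (θ p.1)) p.2)
    ⟨0, Set.forall_mem_range.2 fun p => (hd.one_sub_b_pos hc p.1 p.2).le⟩ (k, s)

/-- Each `1 - b` is positive and they tend to `1`; the infimum is governed by finitely many times
and a tail above `1 / 2`. -/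
lemma kappa_pos [Nonempty S] (hd : M.SoftmaxDynamics θ c h) (hc : 0 < c) :
    0 < M.kappa fun k => softmaxPolicy (θ k) := by
  have hev : ∀ᶠ k in atTop, ∀ s, 1 / 2 ≤ 1 - M.b (softmaxPolicy (θ k)) s :=
    eventually_all.2 fun s => (hd.tendsto_one_sub_b hc s).eventually_const_le (by norm_num)
  obtain ⟨N, hN⟩ := eventually_atTop.1 hev
  obtain ⟨q, -, hq⟩ := Finset.exists_min_image
    (Finset.range (N + 1) ×ˢ (Finset.univ : Finset S))
    (fun p => 1 - M.b (softmaxPolicy (θ p.1)) p.2)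
    ⟨(0, Classical.arbitrary S), by simp⟩
  refine lt_of_lt_of_le (lt_min (hd.one_sub_b_pos hc q.1 q.2) one_half_pos)
    (le_ciInf fun p => ?_)
  rcases lt_or_ge p.1 (N + 1) with hp | hp
  · exact (min_le_left _ _).trans (hq p (by simpa using hp))
  · exact (min_le_right _ _).trans (hN p.1 (by omega) p.2)

end SoftmaxDynamics

end Dynamics
end FiniteMDP

/-! ### Gradient domination and linear rates -/

namespace FiniteMDP

section Rates

set_option linter.unusedSectionVars false

variable {S A : Type*} [Fintype S] [Fintype A] [Nonempty A] {M : FiniteMDP S A}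
  {θ : ℕ → EuclideanSpace ℝ (S × A)} {c : ℝ} {h : ℕ → S → ℝ}

open Classical in
variable (M) in
/-- The policy `π` conditioned on taking an optimal action. -/
noncomputable def conditionedPolicy (π : S → A → ℝ) (s : S) (a : A) : ℝ :=
  if a ∈ M.optimalActions s then π s a / (1 - M.b π s) else 0

lemma sum_conditionedPolicy_mul (π : S → A → ℝ) (s : S) (f : A → ℝ) :
    ∑ a, M.conditionedPolicy π s a * f a =
      (∑ a ∈ M.optimalActions s, π s a * f a) / (1 - M.b π s) := by
  classical
  simp only [conditionedPolicy, ite_mul, zero_mul, Finset.sum_ite_mem, Finset.univ_inter,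
    Finset.sum_div]
  exact Finset.sum_congr rfl fun a _ => by ring

namespace SoftmaxDynamics

lemma conditionedPolicy_mem (hd : M.SoftmaxDynamics θ c h) (hc : 0 < c) (k : ℕ) :
    M.conditionedPolicy (softmaxPolicy (θ k)) ∈ policies S A := by
  intro s
  have hb := hd.one_sub_b_pos hc k s
  refine ⟨fun a => ?_, ?_⟩
  · rw [conditionedPolicy]
    split_ifs
    · exact div_nonneg (softmaxPolicy_pos _ _ _).le hb.le
    · exact le_rfl
  · have := sum_conditionedPolicy_mul (M := M) (softmaxPolicy (θ k)) s fun _ => 1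
    simp only [mul_one] at this
    rw [this, ← one_sub_b (softmaxPolicy_mem _), div_self hb.ne']

/-- A policy supported on the optimal actions is optimal. -/
lemma isOptimal_of_support (hd : M.SoftmaxDynamics θ c h) (hc : 0 < c) {π : S → A → ℝ}
    (hπ : π ∈ policies S A) (hsupp : ∀ s a, a ∉ M.optimalActions s → π s a = 0) :
    M.IsOptimal π := by
  refine ⟨hπ, fun s => le_antisymm (V_le_Vstar hπ s) ?_⟩
  have hstar : ∀ s, M.Vstar s =
      ∑ a, π s a * (M.r s a + M.γ * ∑ s', M.P s a s' * M.Vstar s') := fun s => by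
    calc M.Vstar s = ∑ a, π s a * M.Vstar s := by
          rw [← Finset.sum_mul, policy_sum hπ, one_mul]
      _ = _ := Finset.sum_congr rfl fun a _ => by
        by_cases ha : a ∈ M.optimalActions s
        · rw [hd.mem_optimalActions_iff hc, advStar, sub_eq_zero] at ha
          rw [← ha, hd.Qstar_eq hc]
        · rw [hsupp s a ha, zero_mul, zero_mul]
  have hle := le_div_of_le_add_discounted (M := M) hπ (c := 0)
    (g := fun s => M.Vstar s - M.V π s) (fun s => by
      conv_lhs => rw [hstar s, V_bellman hπ s]
      rw [discounted_sum_comm, zero_add, ← Finset.sum_sub_distrib]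
      refine (Finset.sum_congr rfl fun a _ => ?_).le
      simp only [mul_sub, Finset.sum_sub_distrib]
      ring) s
  rw [zero_div] at hle
  linarith

lemma isOptimal_conditionedPolicy (hd : M.SoftmaxDynamics θ c h) (hc : 0 < c) (k : ℕ) :
    M.IsOptimal (M.conditionedPolicy (softmaxPolicy (θ k))) :=
  hd.isOptimal_of_support hc (hd.conditionedPolicy_mem hc k) fun _ _ ha => if_neg ha

/-- A deterministic optimal policy and the conditioned policy must coincide, yet the latter charges
every optimal action. -/
lemma card_optimalActions_le_one (hd : M.SoftmaxDynamics θ c h) (hc : 0 < c) {πs : S → A → ℝ}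
    (huniq : ∀ π', M.IsOptimal π' → π' = πs) (s : S) : (M.optimalActions s).card ≤ 1 := by
  classical
  choose f hf using fun s => hd.exists_advStar_eq_zero hc s
  have hdet : M.IsOptimal fun s => (Pi.single (f s) 1 : A → ℝ) := by
    refine hd.isOptimal_of_support hc (fun s => single_mem_stdSimplex ℝ (f s)) fun s a ha => ?_
    refine Pi.single_eq_of_ne (fun h => ha ?_) _
    rw [h, hd.mem_optimalActions_iff hc]
    exact hf s
  have heq := (huniq _ hdet).trans (huniq _ (hd.isOptimal_conditionedPolicy hc 0)).symm
  have hall : ∀ a ∈ M.optimalActions s, a = f s := fun a ha => by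
    by_contra hne
    have h1 : (Pi.single (f s) 1 : A → ℝ) a = M.conditionedPolicy (softmaxPolicy (θ 0)) s a :=
      congrFun (congrFun heq s) a
    rw [Pi.single_eq_of_ne hne, conditionedPolicy, if_pos ha] at h1
    exact (div_pos (softmaxPolicy_pos _ _ _) (hd.one_sub_b_pos hc 0 s)).ne h1
  exact Finset.card_le_one.2 fun a ha a' ha' => (hall a ha).trans (hall a' ha').symm

/-- The softmax weight times the advantage is `Â`, so conditioning leaves a sum of `Â` over the
optimal actions divided by `1 - b ≥ κ`. -/
lemma sum_conditionedPolicy_mul_adv_le [Nonempty S] (hd : M.SoftmaxDynamics θ c h) (hc : 0 < c)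
    (k : ℕ) (s : S) :
    ∑ a, M.conditionedPolicy (softmaxPolicy (θ k)) s a * M.adv (softmaxPolicy (θ k)) s a ≤
      (M.optimalActions s).card * M.advHatSup (softmaxPolicy (θ k)) s /
        M.kappa fun k => softmaxPolicy (θ k) := by
  rw [sum_conditionedPolicy_mul]
  have hnum : ∑ a ∈ M.optimalActions s, softmaxPolicy (θ k) s a * M.adv (softmaxPolicy (θ k)) s a ≤
      (M.optimalActions s).card * M.advHatSup (softmaxPolicy (θ k)) s := by
    rw [← nsmul_eq_mul]
    exact Finset.sum_le_card_nsmul _ _ _ fun a _ =>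
      (le_abs_self _).trans (abs_advHat_le_advHatSup (M := M) _ s a)
  exact (div_le_div_of_nonneg_right hnum (hd.one_sub_b_pos hc k s).le).trans
    (div_le_div_of_nonneg_left (mul_nonneg (Nat.cast_nonneg _) (advHatSup_nonneg _ _))
      (hd.kappa_pos hc) (hd.kappa_le hc k s))

variable {ρ : S → ℝ}

lemma suboptimality_nonneg (hρ : ∀ s, 0 ≤ ρ s) {π : S → A → ℝ} (hπ : π ∈ policies S A) :
    0 ≤ M.valueStarAt ρ - M.valueAt π ρ :=
  sub_nonneg.2 (Finset.sum_le_sum fun s _ => mul_le_mul_of_nonneg_left (V_le_Vstar hπ s) (hρ s))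

lemma valueAt_gain_le (hd : M.SoftmaxDynamics θ c h) (hc : 0 ≤ c) (hρ : ∀ s, 0 ≤ ρ s) (k : ℕ) :
    (∑ s, ρ s * M.advHatSup (softmaxPolicy (θ k)) s) / Fintype.card A * (1 - 1 / (c + 1)) ≤
      M.valueAt (softmaxPolicy (θ (k + 1))) ρ - M.valueAt (softmaxPolicy (θ k)) ρ := by
  rw [valueAt, valueAt, ← Finset.sum_sub_distrib, Finset.sum_div, Finset.sum_mul]
  refine Finset.sum_le_sum fun s _ => ?_
  rw [← mul_sub, mul_div_assoc, mul_assoc]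
  exact mul_le_mul_of_nonneg_left (hd.gain_le hc k s) (hρ s)

/-- A gradient domination bound with constant `κ / N` yields linear convergence. -/
lemma suboptimality_le_pow (hd : M.SoftmaxDynamics θ c h) (hc : 0 ≤ c)
    (hρ : ∀ s, 0 ≤ ρ s) {q : ℝ}
    (hq : ∀ k, q * (M.valueStarAt ρ - M.valueAt (softmaxPolicy (θ k)) ρ) ≤
      ∑ s, ρ s * M.advHatSup (softmaxPolicy (θ k)) s) (k : ℕ) :
    M.valueStarAt ρ - M.valueAt (softmaxPolicy (θ k)) ρ ≤
      (1 - q / Fintype.card A * (1 - 1 / (c + 1))) ^ k *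
        (M.valueStarAt ρ - M.valueAt (softmaxPolicy (θ 0)) ρ) := by
  refine le_pow_mul_of_succ_le_mul
    (x := fun k => M.valueStarAt ρ - M.valueAt (softmaxPolicy (θ k)) ρ)
    (fun k => suboptimality_nonneg hρ (softmaxPolicy_mem _)) (fun k => ?_) k
  have hf : 0 ≤ 1 - 1 / (c + 1) := by
    have : 1 - 1 / (c + 1) = c / (c + 1) := by field_simp; ring
    rw [this]; positivity
  have h1 := hd.valueAt_gain_le hc hρ k
  have h2 := mul_le_mul_of_nonneg_right
    (div_le_div_of_nonneg_right (hq k) (Nat.cast_nonneg (Fintype.card A))) hf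
  have h3 : q * (M.valueStarAt ρ - M.valueAt (softmaxPolicy (θ k)) ρ) / Fintype.card A *
      (1 - 1 / (c + 1)) = q / Fintype.card A * (1 - 1 / (c + 1)) *
        (M.valueStarAt ρ - M.valueAt (softmaxPolicy (θ k)) ρ) := by ring
  rw [h3] at h2
  linarith

lemma one_le_iSup_card_optimalActions [Nonempty S] (hd : M.SoftmaxDynamics θ c h) (hc : 0 < c) :
    (1 : ℝ) ≤ ⨆ s, ((M.optimalActions s).card : ℝ) := by
  obtain ⟨a, ha⟩ := hd.exists_advStar_eq_zero hc (Classical.arbitrary S)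
  have h1 : 1 ≤ (M.optimalActions (Classical.arbitrary S)).card :=
    Finset.card_pos.2 ⟨a, (hd.mem_optimalActions_iff hc).2 ha⟩
  exact (Nat.one_le_cast.2 h1).trans
    (le_ciSup (f := fun s => ((M.optimalActions s).card : ℝ)) (Set.finite_range _).bddAbove _)

/-- The comparison policy, the conditioned one, varies with `k`, so its visitation measure is
avoided: a uniform bound on the one-step residual suffices, at the price of `ρ̃`. -/
lemma gradient_domination [Nonempty S] (hd : M.SoftmaxDynamics θ c h) (hc : 0 < c)
    (hρ : ρ ∈ stdSimplex ℝ S) (k : ℕ) :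
    (1 - M.γ) * (⨅ s, ρ s) * ((M.kappa fun k => softmaxPolicy (θ k)) /
        ⨆ s, ((M.optimalActions s).card : ℝ)) *
      (M.valueStarAt ρ - M.valueAt (softmaxPolicy (θ k)) ρ) ≤
      ∑ s, ρ s * M.advHatSup (softmaxPolicy (θ k)) s := by
  have hN := hd.one_le_iSup_card_optimalActions hc
  have hκ := hd.kappa_pos hc
  set N := ⨆ s, ((M.optimalActions s).card : ℝ)
  set κ := M.kappa fun k => softmaxPolicy (θ k)
  -- The sum over states serves as a crude bound for the maximum over states.
  set X := ∑ s, M.advHatSup (softmaxPolicy (θ k)) s with hX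
  have hopt := hd.isOptimal_conditionedPolicy hc k
  have hMX : ∀ s, M.advHatSup (softmaxPolicy (θ k)) s ≤ X := fun s =>
    Finset.single_le_sum (f := fun s => M.advHatSup (softmaxPolicy (θ k)) s)
      (fun s _ => advHatSup_nonneg _ s) (Finset.mem_univ s)
  have hV : ∀ s, M.Vstar s - M.V (softmaxPolicy (θ k)) s ≤ N * X / κ / (1 - M.γ) := by
    refine le_div_of_le_add_discounted (M := M) hopt.1
      (g := fun s => M.Vstar s - M.V (softmaxPolicy (θ k)) s) fun s => ?_
    simp only [← hopt.2]
    rw [V_sub_V_eq (softmaxPolicy_mem (θ k)) hopt.1 s]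
    refine add_le_add_left ((hd.sum_conditionedPolicy_mul_adv_le hc k s).trans ?_) _
    refine div_le_div_of_nonneg_right (mul_le_mul ?_ (hMX s) (advHatSup_nonneg _ s)
      (by linarith)) hκ.le
    exact le_ciSup (f := fun s => ((M.optimalActions s).card : ℝ)) (Set.finite_range _).bddAbove s
  have hgap : M.valueStarAt ρ - M.valueAt (softmaxPolicy (θ k)) ρ ≤ N * X / κ / (1 - M.γ) := by
    rw [valueStarAt, valueAt, ← Finset.sum_sub_distrib]
    calc _ ≤ ∑ s, ρ s * (N * X / κ / (1 - M.γ)) := Finset.sum_le_sum fun s _ => by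
          rw [← mul_sub]; exact mul_le_mul_of_nonneg_left (hV s) (hρ.1 s)
      _ = _ := by rw [← Finset.sum_mul, hρ.2, one_mul]
  have hρ0 : 0 ≤ ⨅ s, ρ s := Real.iInf_nonneg hρ.1
  have hγ := M.one_sub_γ_pos
  calc _ ≤ (1 - M.γ) * (⨅ s, ρ s) * (κ / N) * (N * X / κ / (1 - M.γ)) :=
        mul_le_mul_of_nonneg_left hgap (by positivity)
    _ = (⨅ s, ρ s) * X := by
        have : N ≠ 0 := by linarith
        field_simp
    _ ≤ _ := by
        rw [hX, Finset.mul_sum]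
        exact Finset.sum_le_sum fun s _ => mul_le_mul_of_nonneg_right
          (ciInf_le (Set.finite_range _).bddBelow s) (advHatSup_nonneg _ s)

/-- Uniqueness makes the conditioned policy equal to `πs` for every `k`, so the performance
difference lemma with its fixed visitation measure applies, and leaves one optimal action per state.
-/
lemma gradient_domination_of_unique [Nonempty S] (hd : M.SoftmaxDynamics θ c h) (hc : 0 < c)
    (hρ : ∀ s, 0 < ρ s) {πs : S → A → ℝ} (huniq : ∀ π', M.IsOptimal π' → π' = πs) (k : ℕ) :
    (1 - M.γ) * ‖(fun s => M.visitation πs ρ s / ρ s)‖⁻¹ *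
        (M.kappa fun k => softmaxPolicy (θ k)) *
      (M.valueStarAt ρ - M.valueAt (softmaxPolicy (θ k)) ρ) ≤
      ∑ s, ρ s * M.advHatSup (softmaxPolicy (θ k)) s := by
  have hκ := hd.kappa_pos hc
  have hopt := hd.isOptimal_conditionedPolicy hc k
  rw [← huniq _ hopt]
  set πo := M.conditionedPolicy (softmaxPolicy (θ k))
  have hL := fun s => hd.sum_conditionedPolicy_mul_adv_le hc k s
  set κ := M.kappa fun k => softmaxPolicy (θ k)
  set D := ‖(fun s => M.visitation πo ρ s / ρ s)‖
  have hρ0 : ∀ s, 0 ≤ ρ s := fun s => (hρ s).le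
  have hγ := M.one_sub_γ_pos
  have hstar : M.valueStarAt ρ = M.valueAt πo ρ := by simp only [valueStarAt, valueAt, hopt.2]
  have hvis : ∀ s, M.visitation πo ρ s ≤ D * ρ s := fun s => by
    rw [← div_le_iff₀ (hρ s)]
    exact (le_abs_self _).trans (norm_le_pi_norm (fun s => M.visitation πo ρ s / ρ s) s)
  have hvis0 : ∀ s, 0 ≤ M.visitation πo ρ s := fun s => by
    rw [visitation_eq hopt.1 hρ0]
    exact mul_nonneg hγ.le (stateOccupancy_nonneg hopt.1 hρ0 s)
  have hY : 0 ≤ ∑ s, ρ s * M.advHatSup (softmaxPolicy (θ k)) s :=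
    Finset.sum_nonneg fun s _ => mul_nonneg (hρ0 s) (advHatSup_nonneg _ s)
  have hgap : (1 - M.γ) * κ * (M.valueStarAt ρ - M.valueAt (softmaxPolicy (θ k)) ρ) ≤
      D * ∑ s, ρ s * M.advHatSup (softmaxPolicy (θ k)) s := by
    rw [hstar, valueAt_sub_valueAt (softmaxPolicy_mem _) hopt.1 hρ0, Finset.mul_sum,
      Finset.mul_sum]
    refine Finset.sum_le_sum fun s _ => ?_
    have h1 : κ * ∑ a, πo s a * M.adv (softmaxPolicy (θ k)) s a ≤
        M.advHatSup (softmaxPolicy (θ k)) s := by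
      have h2 := (le_div_iff₀ hκ).1 (hL s)
      have h3 : ((M.optimalActions s).card : ℝ) ≤ 1 := by
        exact_mod_cast hd.card_optimalActions_le_one hc huniq s
      rw [mul_comm]
      exact h2.trans (mul_le_of_le_one_left (advHatSup_nonneg _ s) h3)
    calc _ = M.visitation πo ρ s * (κ * ∑ a, πo s a * M.adv (softmaxPolicy (θ k)) s a) := by
          rw [visitation_eq hopt.1 hρ0]; ring
      _ ≤ M.visitation πo ρ s * M.advHatSup (softmaxPolicy (θ k)) s :=
          mul_le_mul_of_nonneg_left h1 (hvis0 s)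
      _ ≤ D * ρ s * M.advHatSup (softmaxPolicy (θ k)) s :=
          mul_le_mul_of_nonneg_right (hvis s) (advHatSup_nonneg _ s)
      _ = _ := by ring
  calc _ = D⁻¹ * ((1 - M.γ) * κ * (M.valueStarAt ρ - M.valueAt (softmaxPolicy (θ k)) ρ)) := by
        ring
    _ ≤ _ := inv_mul_le_of_le_mul₀ (norm_nonneg _) hY hgap

end SoftmaxDynamics

end Rates
end FiniteMDP

/-! ### The convergence theorem -/

theorem theorem4p7 {S A : Type*} [Fintype S] [Fintype A] [Nonempty A] (M : FiniteMDP S A)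
    (μ ρ : S → ℝ) (hμ : μ ∈ stdSimplex ℝ S) (hμ_pos : 0 < ⨅ s, μ s) (hρ : ρ ∈ stdSimplex ℝ S)
    (η : ℕ → ℝ) (θ : ℕ → EuclideanSpace ℝ (S × A)) (hθ : M.IsSoftmaxPG μ η θ)
    (π : ℕ → S → A → ℝ) (hπ : ∀ k, π k = softmaxPolicy (θ k))
    (C : ℝ) (hC : 0 < C)
    (hη : ∀ k, (M.activeStates (π k)).Nonempty →
      C / (⨅ s : M.activeStates (π k), ⨆ a, |M.advHat (π k) s a|) ≤ η k) :
    (∀ k, M.activeStates (π k) = {s | 0 < ⨆ a, M.advHat (π k) s a}) ∧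
    0 < M.kappa π ∧
    (∀ k, M.valueStarAt ρ - M.valueAt (π k) ρ ≤
      (1 - (1 - M.γ) * (⨅ s, ρ s) *
          (M.kappa π / (Fintype.card A * ⨆ s, ((M.optimalActions s).card : ℝ))) *
          (1 - 1 / (C * (⨅ s, μ s) + 1))) ^ k *
        (M.valueStarAt ρ - M.valueAt (π 0) ρ)) ∧
    ((0 < ⨅ s, ρ s) →
      ∀ πs : S → A → ℝ, M.IsOptimal πs → (∀ π', M.IsOptimal π' → π' = πs) →
      ∀ k, M.valueStarAt ρ - M.valueAt (π k) ρ ≤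
        (1 - (1 - M.γ) * ‖(fun s => M.visitation πs ρ s / ρ s)‖⁻¹ *
            (M.kappa π / Fintype.card A) *
            (1 - 1 / (C * (⨅ s, μ s) + 1))) ^ k *
          (M.valueStarAt ρ - M.valueAt (π 0) ρ)) := by
  obtain rfl : π = fun k => softmaxPolicy (θ k) := funext hπ
  have : Nonempty S := by
    by_contra hS
    have := not_nonempty_iff.1 hS
    simpa using hμ.2
  obtain ⟨h, hd⟩ := FiniteMDP.IsSoftmaxPG.exists_softmaxDynamics hθ hC hμ_pos hη
  have hc := mul_pos hC hμ_pos
  refine ⟨fun k => FiniteMDP.activeStates_eq (softmaxPolicy_mem _), hd.kappa_pos hc,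
    fun k => ?_, fun hρ_pos πs _ huniq k => ?_⟩
  · refine (hd.suboptimality_le_pow hc.le hρ.1 (hd.gradient_domination hc hρ) k).trans_eq ?_
    congr 3
    rw [div_mul_eq_div_div_swap]
    ring
  · have hρ' : ∀ s, 0 < ρ s := fun s =>
      hρ_pos.trans_le (ciInf_le (Set.finite_range _).bddBelow s)
    refine (hd.suboptimality_le_pow hc.le hρ.1
      (hd.gradient_domination_of_unique hc hρ' huniq) k).trans_eq ?_
    congr 3
    ring
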